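/- Let $C=(C_{ijkl})_{1\le i,j,k,l\le 3}$ be a real tensor with $C_{ijkl}=C_{kjil}=C_{ilkj}$, and for $\xi\in\mathbb{R}^{3\times 3}$ let $f(\xi)=\xi C\xi^T=\sum_{i,j,k,l}C_{ijkl}\,\xi_{ij}\xi_{kl}$. Let $\mathcal{C}_3$ be the convex cone of all quadratic forms $g$ on $\mathbb{R}^{3\times 3}$ whose coefficient tensor has these symmetries and which are quasiconvex; for a quadratic form, quasiconvexity means that $g(x\otimes y)\ge 0$ for all $x,y\in\mathbb{R}^3$, where $(x\otimes y)_{ij}=x_iy_j$. The acoustic tensor of $f$ is the symmetric matrix $T(y)$ with entries $T(y)_{ik}=\sum_{j,l}C_{ijkl}\,y_jy_l$, so that $f(x\otimes y)=x\,T(y)\,x^T$. A homogeneous polynomial $P$ of degree exactly $2n$ is called extremal if $P\ge 0$ everywhere and $P$ is not the sum of two linearly independent nonnegative homogeneous polynomials of degree $2n$. A form $f\in\mathcal{C}_3$ is called an extreme ray of $\mathcal{C}_3$ if $f\neq 0$ and every $g\in\mathcal{C}_3$ with $f-g\in\mathcal{C}_3$ is a scalar multiple of $f$. A function on $\mathbb{R}^{3\times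 3}$ is called polyconvex if it is a convex function of the vector of all minors (of orders $1,2,3$) of $\xi$. **Theorem 2.1.** Suppose that $f\in\mathcal{C}_3$ and that $\det T(y)$ is an extremal polynomial. 1. If $\det T(y)$ is not a perfect square (the square of a real polynomial), then $f$ is an extreme ray of $\mathcal{C}_3$. 2. If $\det T(y)$ is a perfect square, then $f$ is an extreme ray of $\mathcal{C}_3$, or $f$ is polyconvex and the biquadratic form $f(x\otimes y)$ is a sum of squares of bilinear forms in $x$ and $y$. -/

import Mathlib

open scoped BigOperators

/-- Real fourth order tensors `C = (C_ijkl)` with all indices in `{1, …, d}`. -/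
abbrev FourTensor (d : ℕ) : Type := Fin d → Fin d → Fin d → Fin d → ℝ

/-- The usual symmetries `C_ijkl = C_kjil = C_ilkj`. -/
def FourTensor.HasUsualSymmetries {d : ℕ} (C : FourTensor d) : Prop :=
  ∀ i j k l, C i j k l = C k j i l ∧ C i j k l = C i l k j

/-- The quadratic form `ξ ↦ ξ C ξᵀ = ∑ C_ijkl ξ_ij ξ_kl` on `d × d` matrices. -/
def FourTensor.form {d : ℕ} (C : FourTensor d) (ξ : Matrix (Fin d) (Fin d) ℝ) : ℝ :=
  ∑ i, ∑ j, ∑ k, ∑ l, C i j k l * ξ i j * ξ k l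

/-- The acoustic tensor (the `y`-matrix) `T(y)`, as a matrix of polynomials in `y`:
`T(y)_ik = ∑ C_ijkl y_j y_l`, so that `f (x ⊗ y) = x T(y) xᵀ`. -/
noncomputable def FourTensor.acousticTensor {d : ℕ} (C : FourTensor d) :
    Matrix (Fin d) (Fin d) (MvPolynomial (Fin d) ℝ) :=
  Matrix.of fun i k =>
    ∑ j, ∑ l, MvPolynomial.C (C i j k l) * MvPolynomial.X j * MvPolynomial.X l

/-- The convex cone `C_d` of quasiconvex quadratic forms on `d × d` matrices whose coefficient
tensor has the usual symmetries. A quadratic form is quasiconvex iff it satisfies the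
Legendre-Hadamard condition `f (x ⊗ y) ≥ 0`, i.e. iff the biquadratic form `f (x ⊗ y)` is
nonnegative. A form with the usual symmetries is determined by its values on rank-one matrices;
thus the symmetries normalize forms modulo linear combinations of `2 × 2` minors, which vanish on
rank-one matrices. -/
def quasiconvexCone (d : ℕ) : Set (Matrix (Fin d) (Fin d) ℝ → ℝ) :=
  {f | (∃ C : FourTensor d, C.HasUsualSymmetries ∧ f = C.form) ∧
    ∀ x y : Fin d → ℝ, 0 ≤ f (Matrix.vecMulVec x y)}

/-- `f` spans an extreme ray of `C_d` (is a strong extremal): `f` is a nonzero element of `C_d`,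
and no form of `C_d` other than a multiple of `f` can be subtracted from `f` inside `C_d`. -/
def IsExtremeRay {d : ℕ} (f : Matrix (Fin d) (Fin d) ℝ → ℝ) : Prop :=
  f ∈ quasiconvexCone d ∧ f ≠ 0 ∧
    ∀ g ∈ quasiconvexCone d, f - g ∈ quasiconvexCone d → ∃ c : ℝ, g = c • f

/-- The indices of the minors of a `d × d` matrix: an order `k + 1` with `1 ≤ k + 1 ≤ d`, and
`k + 1` rows and `k + 1` columns, listed increasingly. -/
abbrev MinorIndex (d : ℕ) : Type :=
  Σ k : Fin d, (Fin (k + 1) ↪o Fin d) × (Fin (k + 1) ↪o Fin d)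

/-- The vector of all minors, including the first order ones, of a matrix. -/
def minors {d : ℕ} (ξ : Matrix (Fin d) (Fin d) ℝ) : MinorIndex d → ℝ :=
  fun m => (ξ.submatrix m.2.1 m.2.2).det

/-- Polyconvexity (Ball): `f` is a convex function of the minors. -/
def IsPolyconvex {d : ℕ} (f : Matrix (Fin d) (Fin d) ℝ → ℝ) : Prop :=
  ∃ g : (MinorIndex d → ℝ) → ℝ, ConvexOn ℝ Set.univ g ∧ ∀ ξ, f ξ = g (minors ξ)

/-- The biquadratic form `f (x ⊗ y)` is a sum of squares of bilinear forms in `x` and `y`. -/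
def IsBiquadraticSumOfSquares {d : ℕ} (f : Matrix (Fin d) (Fin d) ℝ → ℝ) : Prop :=
  ∃ (m : ℕ) (B : Fin m → Matrix (Fin d) (Fin d) ℝ), ∀ x y : Fin d → ℝ,
    f (Matrix.vecMulVec x y) = ∑ s, (∑ i, ∑ j, B s i j * x i * y j) ^ 2

/-- `P` is a homogeneous polynomial of degree exactly `2 * n` (in particular `P ≠ 0`) that is
nonnegative everywhere. -/
def IsNonnegativeForm {m : ℕ} (n : ℕ) (P : MvPolynomial (Fin m) ℝ) : Prop :=
  P.IsHomogeneous (2 * n) ∧ P ≠ 0 ∧ ∀ x : Fin m → ℝ, 0 ≤ MvPolynomial.eval x P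

/-- Extremal polynomials: nonnegative forms of some degree `2 * n` that are not the sum of two
linearly independent nonnegative forms of the same degree. -/
def IsExtremalPolynomial {m : ℕ} (P : MvPolynomial (Fin m) ℝ) : Prop :=
  ∃ n : ℕ, IsNonnegativeForm n P ∧
    ¬ ∃ P₁ P₂ : MvPolynomial (Fin m) ℝ, IsNonnegativeForm n P₁ ∧ IsNonnegativeForm n P₂ ∧
      LinearIndependent ℝ ![P₁, P₂] ∧ P = P₁ + P₂

/-! Let `T` be the acoustic tensor of `f`, and let `f₁` be a form of the cone with `f - f₁` in the
cone as well, with acoustic tensor `S`, so that `0 ≤ S ≤ T`. The four terms in the expansion of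
`det (S + (T - S))` are nonnegative forms of degree six, hence multiples of the extremal polynomial
`det T`. So `det (S - t T) = p(t) det T` for a real function `p`, and the generalized eigenvalues
of `S` with respect to `T` do not depend on the direction `y`. If `a` is the smallest and `b` the
largest of them, then `S - a T` and `b T - S` are positive semidefinite, with determinant zero for
every `y` (`exists_degenerate_bounds`). If `a = b` then `f₁ = a f`. Otherwise `f` is, up to a factor,
the sum of the two corresponding degenerate forms, and it remains to see that each of them is a sum
of squares of bilinear forms (`isBiquadraticSumOfSquares_of_det_eq_zero`).

The adjugate of a degenerate symmetric `3 × 3` matrix `A` has rank at most one, so over the unique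
factorization domain `ℝ[y]` it is `g u uᵀ` with forms `g ≥ 0` and `u` such that
`deg g + 2 deg u = 4`.
* If `u` is constant, then `u` is in the kernel of `A` for all `y`, the biquadratic form depends on
  two variables `x` only, and it is a sum of squares by a theorem of Calderón
  (`isPencilSumOfSquares_of_nonneg`).
* If `g` is constant it can be absorbed into `u`, so that `adj A = u uᵀ`. Then `A + i (u × ·)` is a
  Hermitian matrix of rank one over `ℂ[y]`, hence of the form `h q* q`; by degree, either `h` is
  constant and `q` linear or `h` is quadratic and `q` constant, and the real part of this
  factorization is a sum of squares (`isBiquadraticSumOfSquares_of_adjugate_eq`).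
* If `g` is quadratic, it is a sum of squares of linear forms and a factor of the mixed term
  `tr (adj A * B)`, where `B` is the other summand. This term is a multiple of the extremal
  polynomial `det T`, so `g` is a single square, which can be absorbed into `u` again.

Finally, if `f (x ⊗ y)` is a sum of squares then `f` is polyconvex, because forms that vanish on
rank-one matrices are combinations of `2 × 2` minors, and `det T` is a sum of squares by the
Cauchy–Binet formula, hence a single square by extremality. -/

/-! ### Factors of forms, and rank-one matrices over polynomial rings -/

namespace MvPolynomial

section Factor

variable {σ K : Type*} [CommRing K]

/-- The substitution `X i ↦ t X i`, with values in polynomials in the new variable `t`. The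
coefficient of `t ^ k` is the homogeneous component of degree `k`. -/
noncomputable def scaleHom (σ K : Type*) [CommRing K] :
    MvPolynomial σ K →ₐ[K] Polynomial (MvPolynomial σ K) :=
  aeval fun i => Polynomial.C (X i) * Polynomial.X

lemma coeff_scaleHom (p : MvPolynomial σ K) (k : ℕ) :
    (scaleHom σ K p).coeff k = homogeneousComponent k p := by
  classical
  induction p using MvPolynomial.induction_on' with
  | monomial d r =>
    have h1 : scaleHom σ K (monomial d r) =
        Polynomial.C (monomial d r) * Polynomial.X ^ d.degree := by
      rw [scaleHom, aeval_monomial, Finsupp.prod]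
      simp only [mul_pow, Finset.prod_mul_distrib, Finset.prod_pow_eq_pow_sum]
      rw [← mul_assoc]
      congr 1
      rw [monomial_eq, Finsupp.prod, map_mul, map_prod]
      simp only [map_pow]
      congr 1
    rw [h1, Polynomial.coeff_C_mul_X_pow, homogeneousComponent_of_mem (n := d.degree)]
    exact isHomogeneous_monomial r rfl
  | add p q hp hq => rw [map_add, Polynomial.coeff_add, hp, hq, map_add]

lemma scaleHom_of_isHomogeneous {p : MvPolynomial σ K} {n : ℕ} (hp : p.IsHomogeneous n) :
    scaleHom σ K p = Polynomial.monomial n p := by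
  classical
  ext1 k
  rw [coeff_scaleHom, Polynomial.coeff_monomial, homogeneousComponent_of_mem hp]
  simp only [eq_comm]

/-- Over a domain, a factor of a nonzero homogeneous polynomial is homogeneous. -/
lemma IsHomogeneous.exists_of_mul [IsDomain K] {p q : MvPolynomial σ K} {n : ℕ}
    (h : (p * q).IsHomogeneous n) (h0 : p * q ≠ 0) :
    ∃ a b, a + b = n ∧ p.IsHomogeneous a ∧ q.IsHomogeneous b := by
  have hinj : ∀ r : MvPolynomial σ K, r ≠ 0 → scaleHom σ K r ≠ 0 := by
    intro r hr h
    apply hr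
    rw [← sum_homogeneousComponent r]
    refine Finset.sum_eq_zero fun k _ => ?_
    rw [← coeff_scaleHom, h, Polynomial.coeff_zero]
  have hp0 := hinj p (left_ne_zero_of_mul h0)
  have hq0 := hinj q (right_ne_zero_of_mul h0)
  have hpq := scaleHom_of_isHomogeneous h
  rw [map_mul] at hpq
  have hd := Polynomial.natDegree_mul hp0 hq0
  have ht := Polynomial.natTrailingDegree_mul hp0 hq0
  rw [hpq, Polynomial.natDegree_monomial_eq n h0] at hd
  rw [hpq, Polynomial.natTrailingDegree_monomial h0] at ht
  have h1 := Polynomial.natTrailingDegree_le_natDegree (scaleHom σ K p)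
  have h2 := Polynomial.natTrailingDegree_le_natDegree (scaleHom σ K q)
  -- equality of trailing and leading degree leaves a single homogeneous component
  have key : ∀ r : MvPolynomial σ K, (scaleHom σ K r).natTrailingDegree =
      (scaleHom σ K r).natDegree → r.IsHomogeneous (scaleHom σ K r).natDegree := by
    intro r hr
    have : r = homogeneousComponent (scaleHom σ K r).natDegree r := by
      conv_lhs => rw [← sum_homogeneousComponent r]
      by_cases hm : (scaleHom σ K r).natDegree ∈ Finset.range (r.totalDegree + 1)
      · refine Finset.sum_eq_single_of_mem _ hm fun k _ hk => ?_
        rw [← coeff_scaleHom]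
        rcases lt_or_gt_of_ne hk with hk | hk
        · exact Polynomial.coeff_eq_zero_of_lt_natTrailingDegree (hr ▸ hk)
        · exact Polynomial.coeff_eq_zero_of_natDegree_lt hk
      · rw [homogeneousComponent_eq_zero (scaleHom σ K r).natDegree r (by simpa using hm)]
        refine Finset.sum_eq_zero fun k hk => ?_
        rw [← coeff_scaleHom]
        refine Polynomial.coeff_eq_zero_of_lt_natTrailingDegree ?_
        simp only [Finset.mem_range] at hk hm
        omega
    have hc := homogeneousComponent_isHomogeneous (scaleHom σ K r).natDegree r
    rwa [← this] at hc
  refine ⟨_, _, hd.symm, key p (by omega), key q (by omega)⟩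

lemma IsHomogeneous.eval_of_degree_one {n : ℕ} {p : MvPolynomial (Fin n) K}
    (hp : p.IsHomogeneous 1) : ∃ c : Fin n → K, ∀ y, eval y p = ∑ i, c i * y i := by
  rw [← mem_homogeneousSubmodule, homogeneousSubmodule_one_eq_span_X] at hp
  induction hp using Submodule.span_induction with
  | mem x hx =>
    obtain ⟨i, rfl⟩ := hx
    exact ⟨Pi.single i 1, fun y => by simp [Pi.single_apply]⟩
  | zero => exact ⟨0, fun y => by simp⟩
  | add p q _ _ hp hq =>
    obtain ⟨c, hc⟩ := hp
    obtain ⟨d, hd⟩ := hq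
    exact ⟨c + d, fun y => by simp [hc, hd, add_mul, Finset.sum_add_distrib]⟩
  | smul a p _ hp =>
    obtain ⟨c, hc⟩ := hp
    exact ⟨a • c, fun y => by simp [hc, Finset.mul_sum, mul_assoc]⟩

lemma IsHomogeneous.eq_C_of_degree_zero {p : MvPolynomial σ K} (hp : p.IsHomogeneous 0) :
    ∃ c, p = C c :=
  ⟨_, totalDegree_eq_zero_iff_eq_C.mp (Nat.le_zero.mp hp.totalDegree_le)⟩

end Factor

/-- A Hermitian matrix of rank one over a polynomial ring is `g q* q` with `q` a row vector, because
the ring has unique factorization. If its entries are forms of degree `d`, then `g` and `q` consist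
of forms. The involution conjugates the coefficients by `τ`; symmetric matrices are the case
`τ = id`. -/
lemma exists_rank_one_factor {σ n K : Type*} [Fintype n] [Field K] (τ : K →+* K)
    (hτ : ∀ a, τ (τ a) = a) (H : Matrix n n (MvPolynomial σ K)) (d : ℕ)
    (hd : ∀ j k, (H j k).IsHomogeneous d)
    (hH : ∀ j k, H j k = map τ (H k j)) (i : n) (hi : H i i ≠ 0)
    (hrk : ∀ j k, H i i * H j k = H j i * H i k) :
    ∃ (a b : ℕ) (g : MvPolynomial σ K) (q : n → MvPolynomial σ K), a + 2 * b = d ∧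
      g.IsHomogeneous a ∧ (∀ k, (q k).IsHomogeneous b) ∧
      ∀ j k, H j k = g * map τ (q j) * q k := by
  classical
  let _ : StrongNormalizationMonoid (MvPolynomial σ K) :=
    UniqueFactorizationMonoid.strongNormalizationMonoid
  let _ : NormalizedGCDMonoid (MvPolynomial σ K) :=
    UniqueFactorizationMonoid.toNormalizedGCDMonoid _
  have hττ : ∀ p : MvPolynomial σ K, map τ (map τ p) = p := by
    intro p
    rw [map_map, RingHom.ext (f := τ.comp τ) (g := RingHom.id K) hτ, map_id]
  have hdvd : ∀ p q : MvPolynomial σ K, map τ p ∣ q → p ∣ map τ q := by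
    intro p q h
    simpa only [hττ] using map_dvd (map τ) h
  -- `q` is the primitive part of row `i`
  obtain ⟨q, hq, hq1⟩ := Finset.extract_gcd (fun k => H i k) ⟨i, Finset.mem_univ i⟩
  set e := Finset.univ.gcd (fun k => H i k) with he
  replace hq : ∀ k, H i k = e * q k := fun k => hq k (Finset.mem_univ k)
  have he0 : e ≠ 0 := fun h => hi (by rw [hq, h, zero_mul])
  have hqi : q i ≠ 0 := fun h => hi (by rw [hq, h, mul_zero])
  have hprim : ∀ p r : MvPolynomial σ K, (∀ k, p ∣ r * q k) → p ∣ r := by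
    intro p r h
    have h1 : p ∣ Finset.univ.gcd (fun k => r * q k) := Finset.dvd_gcd fun k _ => h k
    have h2 := h1.trans (Finset.gcd_mul_left' Finset.univ q r).dvd
    rwa [hq1, mul_one] at h2
  have hcol : ∀ j, H j i = map τ e * map τ (q j) := fun j => by rw [hH, hq, map_mul]
  have hmain : ∀ j k, q i * H j k = map τ e * map τ (q j) * q k := by
    intro j k
    have := hrk j k
    rw [hq i, hq k, hcol j] at this
    refine mul_left_cancel₀ he0 ?_
    linear_combination this
  have h1 : ∀ j, q i ∣ map τ e * map τ (q j) := fun j =>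
    hprim _ _ fun k => ⟨H j k, (hmain j k).symm⟩
  have h2 : q i ∣ map τ e := by
    refine hdvd _ _ (hprim _ _ fun k => ?_)
    have := map_dvd (map τ) (h1 k)
    rwa [map_mul, hττ, hττ] at this
  obtain ⟨g, hg⟩ := h2
  have hfac : ∀ j k, H j k = g * map τ (q j) * q k := by
    intro j k
    refine mul_left_cancel₀ hqi ?_
    rw [hmain, hg]
    ring
  have hii := hfac i i
  obtain ⟨c, b, hcb, hgc, hqb⟩ := IsHomogeneous.exists_of_mul (hii ▸ hd i i) (hii ▸ hi)
  have hgq : g * map τ (q i) ≠ 0 := fun h => hi (by rw [hii, h, zero_mul])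
  obtain ⟨a, b', hab, hga, -⟩ := IsHomogeneous.exists_of_mul hgc hgq
  have hg' := hga.mul (hqb.map τ)
  have hbc : a + b = c := hg'.inj_right hgc hgq
  refine ⟨a, b, g, q, by omega, hga, fun k => ?_, hfac⟩
  by_cases hk : q k = 0
  · rw [hk]; exact isHomogeneous_zero _ _ _
  have hik : g * map τ (q i) * q k ≠ 0 := mul_ne_zero hgq hk
  obtain ⟨c', b'', hcb', hgc', hqk⟩ := IsHomogeneous.exists_of_mul (hfac i k ▸ hd i k) hik
  have h3 : c = c' := hgc.inj_right hgc' hgq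
  have h4 : b'' = b := by omega
  exact h4 ▸ hqk

lemma dense_eval_ne_zero {n : ℕ} {P : MvPolynomial (Fin n) ℝ} (hP : P ≠ 0) :
    Dense {y : Fin n → ℝ | eval y P ≠ 0} := by
  rw [Metric.dense_iff]
  intro y r hr
  by_contra h
  rw [Set.not_nonempty_iff_eq_empty] at h
  refine hP (funext_set (fun i => Metric.ball (y i) r) (fun i => ?_) fun x hx => ?_)
  · rw [Real.ball_eq_Ioo]
    exact Set.Ioo_infinite (by linarith)
  · by_contra hx0
    rw [map_zero] at hx0
    have : x ∈ Metric.ball y r ∩ {y | eval y P ≠ 0} := by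
      refine ⟨?_, hx0⟩
      rw [ball_pi y hr]
      exact hx
    rw [h] at this
    exact this

/-- A continuous inequality that holds off the zero set of a nonzero polynomial holds everywhere. -/
lemma nonneg_of_eval_ne_zero {n : ℕ} {P : MvPolynomial (Fin n) ℝ} (hP : P ≠ 0)
    {φ : (Fin n → ℝ) → ℝ} (hφ : Continuous φ) (h : ∀ y, eval y P ≠ 0 → 0 ≤ φ y) (y) : 0 ≤ φ y :=
  (isClosed_le continuous_const hφ).closure_subset_iff.mpr h (dense_eval_ne_zero hP y)

end MvPolynomial

/-! ### Biquadratic forms in `2 × n` variables -/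

section Pencil

variable {F : Type*} [NormedAddCommGroup F] [InnerProductSpace ℝ F]

/-- `b s t y` is a sum of squares of functions `s * α y + t * β y` with `α` and `β` linear. -/
def IsPencilSumOfSquares (b : ℝ → ℝ → F → ℝ) : Prop :=
  ∃ L : List ((F →L[ℝ] ℝ) × (F →L[ℝ] ℝ)), ∀ s t y,
    b s t y = (L.map fun p => (s * p.1 y + t * p.2 y) ^ 2).sum

/-- The biquadratic form of a symmetric pencil `s ^ 2 P + 2 s t Q + t ^ 2 R`. -/
noncomputable def pencilForm (P Q R : F →L[ℝ] F →L[ℝ] ℝ) (s t : ℝ) (y : F) : ℝ :=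
  s ^ 2 * P y y + 2 * s * t * Q y y + t ^ 2 * R y y

lemma IsPencilSumOfSquares.add {b c : ℝ → ℝ → F → ℝ} (hb : IsPencilSumOfSquares b)
    (hc : IsPencilSumOfSquares c) : IsPencilSumOfSquares fun s t y => b s t y + c s t y := by
  obtain ⟨L, hL⟩ := hb
  obtain ⟨M, hM⟩ := hc
  exact ⟨L ++ M, fun s t y => by simp [hL, hM]⟩

lemma isPencilSumOfSquares_square (α β : F →L[ℝ] ℝ) :
    IsPencilSumOfSquares fun s t y => (s * α y + t * β y) ^ 2 :=
  ⟨[(α, β)], fun s t y => by simp⟩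

lemma isPencilSumOfSquares_norm [FiniteDimensional ℝ F] {μ : ℝ} (hμ : 0 ≤ μ) :
    IsPencilSumOfSquares fun s t (y : F) => μ * ((s ^ 2 + t ^ 2) * ‖y‖ ^ 2) := by
  let e := stdOrthonormalBasis ℝ F
  refine ⟨(List.ofFn fun i => (Real.sqrt μ • innerSL ℝ (e i), 0)) ++
    List.ofFn fun i => (0, Real.sqrt μ • innerSL ℝ (e i)), fun s t y => ?_⟩
  have h := e.sum_sq_norm_inner_right y
  simp only [List.map_append, List.map_ofFn, List.sum_append, List.sum_ofFn, Function.comp_def,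
    smul_apply, innerSL_apply_apply, smul_eq_mul, zero_apply, mul_zero,
    add_zero, zero_add, mul_pow, Real.sq_sqrt hμ, ← Finset.mul_sum]
  rw [← h]
  simp only [Real.norm_eq_abs, sq_abs]
  ring

lemma pencilForm_comp (P Q R : F →L[ℝ] F →L[ℝ] ℝ) {G : Type*} [NormedAddCommGroup G]
    [InnerProductSpace ℝ G] (f : G →L[ℝ] F) (s t : ℝ) (y : G) :
    pencilForm (P.bilinearComp f f) (Q.bilinearComp f f) (R.bilinearComp f f) s t y =
      pencilForm P Q R s t (f y) := rfl

lemma IsPencilSumOfSquares.comp {G : Type*} [NormedAddCommGroup G] [InnerProductSpace ℝ G]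
    {b : ℝ → ℝ → F → ℝ} (hb : IsPencilSumOfSquares b) (f : G →L[ℝ] F) :
    IsPencilSumOfSquares fun s t y => b s t (f y) := by
  obtain ⟨L, hL⟩ := hb
  exact ⟨L.map fun p => (p.1.comp f, p.2.comp f), fun s t y => by
    simp [hL, Function.comp_def]⟩

lemma IsPencilSumOfSquares.rotate {b : ℝ → ℝ → F → ℝ} (hb : IsPencilSumOfSquares b) (c d : ℝ) :
    IsPencilSumOfSquares fun s t y => b (c * s + d * t) (-d * s + c * t) y := by
  obtain ⟨L, hL⟩ := hb
  refine ⟨L.map fun p => (c • p.1 - d • p.2, d • p.1 + c • p.2), fun s t y => ?_⟩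
  simp only [hL, List.map_map, Function.comp_def]
  congr 2
  funext p
  simp
  ring

/-- A vector at which a nonnegative quadratic form vanishes is in its radical. -/
lemma radical_of_nonneg_of_zero {B : F →L[ℝ] F →L[ℝ] ℝ} (hB : ∀ y z, B y z = B z y)
    (h : ∀ y, 0 ≤ B y y) {y₀ : F} (h0 : B y₀ y₀ = 0) (y : F) : B y₀ y = 0 := by
  by_contra hne
  have h1 := h (y + (-(B y y + 1) / (2 * B y₀ y)) • y₀)
  have h2 := hB y y₀
  simp only [map_add, map_smul, add_apply, smul_apply, smul_eq_mul,
    h0, h2] at h1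
  have h3 : -(B y y + 1) / (2 * B y₀ y) * B y₀ y = -(B y y + 1) / 2 := by field_simp
  linarith

lemma pencilForm_add_smul_of_radical {P Q R : F →L[ℝ] F →L[ℝ] ℝ} (hP : ∀ y z, P y z = P z y)
    (hQ : ∀ y z, Q y z = Q z y) (hR : ∀ y z, R y z = R z y) {y₀ : F} (hP0 : ∀ y, P y₀ y = 0)
    (hQ0 : ∀ y, Q y₀ y = 0) (hR0 : ∀ y, R y₀ y = 0) (s t c : ℝ) (y : F) :
    pencilForm P Q R s t (y + c • y₀) = pencilForm P Q R s t y := by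
  simp [pencilForm, hP y y₀, hQ y y₀, hR y y₀, hP0, hQ0, hR0]

/-- Calderón's theorem: a nonnegative biquadratic form in `2 × n` variables is a sum of squares of
bilinear forms. After a multiple of `|x|² |y|²` has been subtracted the form has a zero
`(x₀, y₀)`; completing the square in the direction `y₀` leaves a nonnegative form in fewer
variables `y`. -/
theorem isPencilSumOfSquares_of_nonneg (n : ℕ) : ∀ {F : Type*} [NormedAddCommGroup F]
    [InnerProductSpace ℝ F] [FiniteDimensional ℝ F] (_ : Module.finrank ℝ F = n)
    (P Q R : F →L[ℝ] F →L[ℝ] ℝ) (_ : ∀ y z, P y z = P z y) (_ : ∀ y z, Q y z = Q z y)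
    (_ : ∀ y z, R y z = R z y) (_ : ∀ s t y, 0 ≤ pencilForm P Q R s t y),
    IsPencilSumOfSquares (pencilForm P Q R) := by
  induction n with
  | zero =>
    intro F _ _ _ hF P Q R _ _ _ _
    have := Module.finrank_zero_iff.mp hF
    refine ⟨[], fun s t y => ?_⟩
    simp [pencilForm, Subsingleton.elim y 0]
  | succ n ih =>
    intro F _ _ _ hF P Q R hP hQ hR hb
    -- forms that do not depend on the direction `y₀`
    have hrad : ∀ (y₀ : F), y₀ ≠ 0 → ∀ (P Q R : F →L[ℝ] F →L[ℝ] ℝ)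
        (_ : ∀ y z, P y z = P z y) (_ : ∀ y z, Q y z = Q z y) (_ : ∀ y z, R y z = R z y)
        (_ : ∀ s t y, 0 ≤ pencilForm P Q R s t y)
        (_ : ∀ y, P y₀ y = 0) (_ : ∀ y, Q y₀ y = 0) (_ : ∀ y, R y₀ y = 0),
        IsPencilSumOfSquares (pencilForm P Q R) := by
      intro y₀ hy₀ P Q R hP hQ hR hb hP0 hQ0 hR0
      let V := (Submodule.span ℝ {y₀})ᗮ
      have hV : Module.finrank ℝ V = n := by
        have : Fact (Module.finrank ℝ F = n + 1) := ⟨hF⟩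
        exact Submodule.finrank_orthogonal_span_singleton hy₀
      have h := ih hV (P.bilinearComp V.subtypeL V.subtypeL) (Q.bilinearComp V.subtypeL V.subtypeL)
        (R.bilinearComp V.subtypeL V.subtypeL) (fun y z => hP _ _) (fun y z => hQ _ _)
        (fun y z => hR _ _) (fun s t y => hb s t _)
      have h2 := h.comp V.orthogonalProjectionOnto
      convert h2 using 4 with s t y
      rw [pencilForm_comp]
      have hy : (y - (V.orthogonalProjectionOnto y : F)) ∈ Vᗮ := by
        exact Submodule.sub_starProjection_mem_orthogonal y
      rw [Submodule.orthogonal_orthogonal, Submodule.mem_span_singleton] at hy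
      obtain ⟨c, hc⟩ := hy
      have : y = V.subtypeL (V.orthogonalProjectionOnto y) + c • y₀ := by
        rw [hc]; simp
      conv_lhs => rw [this]
      rw [pencilForm_add_smul_of_radical hP hQ hR hP0 hQ0 hR0]
    -- forms with a zero at `((1, 0), y₀)`
    have hzero : ∀ (y₀ : F), y₀ ≠ 0 → ∀ (P Q R : F →L[ℝ] F →L[ℝ] ℝ)
        (_ : ∀ y z, P y z = P z y) (_ : ∀ y z, Q y z = Q z y) (_ : ∀ y z, R y z = R z y)
        (_ : ∀ s t y, 0 ≤ pencilForm P Q R s t y)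
        (_ : P y₀ y₀ = 0), IsPencilSumOfSquares (pencilForm P Q R) := by
      intro y₀ hy₀ P Q R hP hQ hR hb hP00
      have hP0 := radical_of_nonneg_of_zero hP
        (fun y => by simpa [pencilForm] using hb 1 0 y) hP00
      have hr : 0 ≤ R y₀ y₀ := by simpa [pencilForm] using hb 0 1 y₀
      have hQ00 : Q y₀ y₀ = 0 := by
        by_contra hne
        have h1 := hb (-(R y₀ y₀ + 1) / (2 * Q y₀ y₀)) 1 y₀
        simp only [pencilForm, hP00] at h1
        have h3 : 2 * (-(R y₀ y₀ + 1) / (2 * Q y₀ y₀)) * 1 * Q y₀ y₀ = -(R y₀ y₀ + 1) := by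
          field_simp
        linarith
      rcases hr.eq_or_lt with hr | hr
      · have hcomb : ∀ s t y, 2 * s * t * Q y₀ y + t ^ 2 * R y₀ y = 0 := by
          intro s t y
          have := radical_of_nonneg_of_zero
            (B := s ^ 2 • P + (2 * s * t) • Q + t ^ 2 • R)
            (fun y z => by simp [hP y z, hQ y z, hR y z])
            (fun y => by simpa [pencilForm] using hb s t y) (y₀ := y₀)
            (by simp [hP00, hQ00, ← hr]) y
          simpa [hP0] using this
        have hR0 : ∀ y, R y₀ y = 0 := fun y => by simpa using hcomb 0 1 y
        have hQ0 : ∀ y, Q y₀ y = 0 := fun y => by simpa [hR0] using hcomb 1 1 y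
        exact hrad y₀ hy₀ P Q R hP hQ hR hb hP0 hQ0 hR0
      · set r := R y₀ y₀ with hrdef
        let q := Q y₀
        let ρ := R y₀
        let P' := P - (4 / r) • q.smulRight q
        let Q' := Q - (1 / r) • (q.smulRight ρ + ρ.smulRight q)
        let R' := R - (1 / r) • ρ.smulRight ρ
        have hP' : ∀ y z, P' y z = P' z y := fun y z => by simp [P', hP y z]; left; ring
        have hQ' : ∀ y z, Q' y z = Q' z y := fun y z => by simp [Q', hQ y z]; ring
        have hR' : ∀ y z, R' y z = R' z y := fun y z => by simp [R', hR y z]; left; ring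
        have hP0' : ∀ y, P' y₀ y = 0 := fun y => by simp [P', q, hP0, hQ00]
        have hQ0' : ∀ y, Q' y₀ y = 0 := fun y => by
          simp [Q', q, ρ, hQ00, ← hrdef]; field_simp; simp
        have hR0' : ∀ y, R' y₀ y = 0 := fun y => by
          simp [R', ρ, ← hrdef]; field_simp; simp
        have hsq : ∀ s t y, pencilForm P Q R s t y =
            pencilForm P' Q' R' s t y + (2 * s * q y + t * ρ y) ^ 2 / r := by
          intro s t y
          simp [pencilForm, P', Q', R']
          ring
        have hpos : ∀ s t y, t ≠ 0 → 0 ≤ pencilForm P' Q' R' s t y := by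
          intro s t y ht
          -- move along `y₀` to where the square vanishes
          have h1 := hb s t (y + (-(2 * s * q y + t * ρ y) / (t * r)) • y₀)
          rw [hsq, pencilForm_add_smul_of_radical hP' hQ' hR' hP0' hQ0' hR0'] at h1
          have h2 : 2 * s * q (y + (-(2 * s * q y + t * ρ y) / (t * r)) • y₀) +
              t * ρ (y + (-(2 * s * q y + t * ρ y) / (t * r)) • y₀) = 0 := by
            simp only [q, ρ, map_add, map_smul, smul_eq_mul, hQ00, ← hrdef]
            field_simp
            ring
          rw [h2] at h1
          simpa using h1
        have hpos' : ∀ s t y, 0 ≤ pencilForm P' Q' R' s t y := by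
          intro s t y
          have hd : Dense {t : ℝ | t ≠ 0} := dense_compl_singleton 0
          have hc : IsClosed {t : ℝ | 0 ≤ pencilForm P' Q' R' s t y} := by
            refine isClosed_le continuous_const ?_
            unfold pencilForm
            fun_prop
          exact hc.closure_subset_iff.mpr (fun t ht => hpos s t y ht) (hd t)
        have h := (hrad y₀ hy₀ P' Q' R' hP' hQ' hR' hpos' hP0' hQ0' hR0').add
          (isPencilSumOfSquares_square ((2 / Real.sqrt r) • q) ((1 / Real.sqrt r) • ρ))
        convert h using 4 with s t y
        rw [hsq]
        congr 1
        have : r = Real.sqrt r ^ 2 := (Real.sq_sqrt hr.le).symm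
        have hs : Real.sqrt r ≠ 0 := (Real.sqrt_pos.mpr hr).ne'
        conv_lhs => rw [this]
        simp only [smul_apply, smul_eq_mul]
        field_simp
    have : Nontrivial F := Module.nontrivial_of_finrank_pos (R := ℝ) (by omega)
    obtain ⟨⟨z₀, y₀⟩, ⟨hz₀, hy₀⟩, hmin⟩ :=
      ((isCompact_sphere (0 : ℂ) 1).prod (isCompact_sphere (0 : F) 1)).exists_isMinOn
        ((NormedSpace.sphere_nonempty.mpr zero_le_one).prod
          (NormedSpace.sphere_nonempty.mpr zero_le_one))
        (f := fun p : ℂ × F => pencilForm P Q R p.1.re p.1.im p.2)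
        (by unfold pencilForm; fun_prop)
    rw [mem_sphere_zero_iff_norm] at hz₀ hy₀
    simp only at hz₀ hy₀
    set c := z₀.re
    set d := z₀.im
    have hcd : c ^ 2 + d ^ 2 = 1 := by
      have := Complex.sq_norm z₀
      rw [hz₀, Complex.normSq_apply] at this
      linarith
    set μ := pencilForm P Q R c d y₀ with hμ
    have hlow : ∀ s t y, μ * ((s ^ 2 + t ^ 2) * ‖y‖ ^ 2) ≤ pencilForm P Q R s t y := by
      intro s t y
      by_cases hy : y = 0
      · simp [hy, pencilForm]
      by_cases hst : (⟨s, t⟩ : ℂ) = 0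
      · obtain ⟨rfl, rfl⟩ : s = 0 ∧ t = 0 := by simpa [Complex.ext_iff] using hst
        simp [pencilForm]
      set ν := ‖(⟨s, t⟩ : ℂ)‖ with hν
      have hν0 : 0 < ν := norm_pos_iff.mpr hst
      have hy0 : 0 < ‖y‖ := norm_pos_iff.mpr hy
      have hν2 : ν ^ 2 = s ^ 2 + t ^ 2 := by
        rw [hν, Complex.sq_norm, Complex.normSq_apply]; ring
      have h1 := hmin (a := ((ν⁻¹ : ℝ) • (⟨s, t⟩ : ℂ), (‖y‖⁻¹ : ℝ) • y))
        ⟨by simp [← hν, abs_of_pos hν0, hν0.ne'],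
          by simp [norm_smul, hy0.ne']⟩
      simp only [Set.mem_ofPred_eq, Complex.smul_re, Complex.smul_im] at h1
      have h2 : pencilForm P Q R (ν⁻¹ • s) (ν⁻¹ • t) (‖y‖⁻¹ • y) =
          pencilForm P Q R s t y / (ν ^ 2 * ‖y‖ ^ 2) := by
        simp only [pencilForm, map_smul, smul_apply, smul_eq_mul]
        field_simp
      rw [h2, le_div_iff₀ (by positivity), hν2] at h1
      exact h1
    have hμ0 : 0 ≤ μ := hb _ _ _
    obtain ⟨I, hI'⟩ : ∃ I : F →L[ℝ] F →L[ℝ] ℝ, I = innerSL ℝ := ⟨_, rfl⟩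
    have hI : ∀ y z, I y z = inner ℝ y z := fun y z => by
      rw [hI']; exact innerSL_apply_apply ℝ y z
    let P₁ := P - μ • I
    let R₁ := R - μ • I
    have hP₁ : ∀ y z, P₁ y z = P₁ z y := fun y z => by
      simp [P₁, hI, hP y z, real_inner_comm z y]
    have hR₁ : ∀ y z, R₁ y z = R₁ z y := fun y z => by
      simp [R₁, hI, hR y z, real_inner_comm z y]
    have hdec : ∀ s t y, pencilForm P Q R s t y =
        pencilForm P₁ Q R₁ s t y + μ * ((s ^ 2 + t ^ 2) * ‖y‖ ^ 2) := by
      intro s t y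
      simp [pencilForm, P₁, R₁, hI]
      ring
    have hb₁ : ∀ s t y, 0 ≤ pencilForm P₁ Q R₁ s t y := fun s t y => by
      linarith [hdec s t y, hlow s t y]
    -- rotate the zero to `((1, 0), y₀)`
    let P₂ := c ^ 2 • P₁ + (2 * c * d) • Q + d ^ 2 • R₁
    let Q₂ := (-(c * d)) • P₁ + (c ^ 2 - d ^ 2) • Q + (c * d) • R₁
    let R₂ := d ^ 2 • P₁ + (-(2 * c * d)) • Q + c ^ 2 • R₁
    have hrot : ∀ s t y, pencilForm P₂ Q₂ R₂ s t y =
        pencilForm P₁ Q R₁ (c * s - d * t) (d * s + c * t) y := by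
      intro s t y
      simp [pencilForm, P₂, Q₂, R₂]
      ring
    have h := hzero y₀ (by rintro rfl; simp at hy₀) P₂ Q₂ R₂
      (fun y z => by simp [P₂, hP₁ y z, hQ y z, hR₁ y z])
      (fun y z => by simp [Q₂, hP₁ y z, hQ y z, hR₁ y z])
      (fun y z => by simp [R₂, hP₁ y z, hQ y z, hR₁ y z])
      (fun s t y => by rw [hrot]; exact hb₁ _ _ _)
      (by
        have h1 := hrot 1 0 y₀
        have h2 := hdec c d y₀
        rw [hcd, hy₀, ← hμ] at h2
        simp only [mul_one, mul_zero, sub_zero, add_zero] at h1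
        have h3 : pencilForm P₂ Q₂ R₂ 1 0 y₀ = P₂ y₀ y₀ := by simp [pencilForm]
        rw [← h3, h1]
        linarith)
    have h' := (h.rotate c d).add (isPencilSumOfSquares_norm (F := F) hμ0)
    convert h' using 4 with s t y
    rw [hdec, hrot]
    have h1 : c * (c * s + d * t) - d * (-d * s + c * t) = s := by linear_combination s * hcd
    have h2 : d * (c * s + d * t) + c * (-d * s + c * t) = t := by linear_combination t * hcd
    rw [h1, h2]

end Pencil

/-! ### Real symmetric matrices and the Cauchy–Binet formula -/

section RealMatrix

open Matrix
open scoped MatrixOrder Matrix.Norms.L2Operator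

variable {n : Type*} [Fintype n] [DecidableEq n]

/-- Simultaneous diagonalization of a symmetric and a positive definite form. -/
lemma exists_simultaneous_diagonalization {S T : Matrix n n ℝ} (hT : T.PosDef)
    (hS : S.IsHermitian) :
    ∃ (P : Matrix n n ℝ) (μ : n → ℝ), T = Pᵀ * P ∧ S = Pᵀ * diagonal μ * P := by
  obtain ⟨L, hL, rfl⟩ := CStarAlgebra.isStrictlyPositive_iff_eq_star_mul_self.mp
    hT.isStrictlyPositive
  rw [star_eq_conjTranspose, conjTranspose_eq_transpose_of_trivial] at *
  have hLd : IsUnit L.det := (isUnit_iff_isUnit_det L).mp hL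
  have hN : (L⁻¹ᵀ * S * L⁻¹).IsHermitian := by
    have := isHermitian_conjTranspose_mul_mul L⁻¹ hS
    rwa [conjTranspose_eq_transpose_of_trivial] at this
  set U : Matrix n n ℝ := hN.eigenvectorUnitary.1
  have hUU : U * star U = 1 := Unitary.mul_star_self_of_mem hN.eigenvectorUnitary.2
  have hsp := hN.spectral_theorem
  rw [Unitary.conjStarAlgAut_apply] at hsp
  have hsp' : L⁻¹ᵀ * S * L⁻¹ = U * diagonal hN.eigenvalues * star U := hsp
  rw [star_eq_conjTranspose, conjTranspose_eq_transpose_of_trivial] at hUU hsp'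
  refine ⟨Uᵀ * L, hN.eigenvalues, ?_, ?_⟩
  · rw [transpose_mul, transpose_transpose]
    calc Lᵀ * L = Lᵀ * (U * Uᵀ) * L := by rw [hUU, mul_one]
      _ = _ := by simp only [Matrix.mul_assoc]
  · rw [transpose_mul, transpose_transpose]
    calc S = (Lᵀ * L⁻¹ᵀ) * S * (L⁻¹ * L) := by
          rw [← transpose_mul, nonsing_inv_mul L hLd, transpose_one, mul_one, one_mul]
      _ = Lᵀ * (L⁻¹ᵀ * S * L⁻¹) * L := by simp only [Matrix.mul_assoc]
      _ = Lᵀ * (U * diagonal hN.eigenvalues * Uᵀ) * L := congrArg (fun X => Lᵀ * X * L) hsp'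
      _ = _ := by simp only [Matrix.mul_assoc]

lemma posSemidef_adjugate {A : Matrix n n ℝ} (hA : A.PosSemidef) : A.adjugate.PosSemidef := by
  obtain ⟨B, rfl⟩ := CStarAlgebra.nonneg_iff_eq_star_mul_self.mp hA.nonneg
  rw [star_eq_conjTranspose, adjugate_mul_distrib, ← adjugate_conjTranspose]
  exact posSemidef_self_mul_conjTranspose _

lemma trace_mul_nonneg {A B : Matrix n n ℝ} (hA : A.PosSemidef) (hB : B.PosSemidef) :
    0 ≤ (A * B).trace := by
  obtain ⟨M, rfl⟩ := CStarAlgebra.nonneg_iff_eq_star_mul_self.mp hB.nonneg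
  rw [star_eq_conjTranspose, ← Matrix.mul_assoc, Matrix.trace_mul_comm, ← Matrix.mul_assoc]
  exact (hA.mul_mul_conjTranspose_same M).trace_nonneg

lemma eq_zero_of_trace_mul_eq_zero {A B : Matrix n n ℝ} (hA : A.PosSemidef) (hB : B.PosDef)
    (h : (A * B).trace = 0) : A = 0 := by
  obtain ⟨M, hM, rfl⟩ := CStarAlgebra.isStrictlyPositive_iff_eq_star_mul_self.mp
    hB.isStrictlyPositive
  rw [star_eq_conjTranspose, ← Matrix.mul_assoc, Matrix.trace_mul_comm, ← Matrix.mul_assoc,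
    (hA.mul_mul_conjTranspose_same M).trace_eq_zero_iff] at h
  have hM' : IsUnit Mᴴ := hM.star
  rwa [hM'.mul_left_eq_zero, hM.mul_right_eq_zero] at h

lemma det_add_smul_fin_three {R : Type*} [CommRing R] (A B : Matrix (Fin 3) (Fin 3) R) (a b : R) :
    (a • A + b • B).det = a ^ 3 * A.det + a ^ 2 * b * (A.adjugate * B).trace +
      a * b ^ 2 * (B.adjugate * A).trace + b ^ 3 * B.det := by
  simp only [det_fin_three, adjugate_fin_three, trace_fin_three, Matrix.add_apply, Matrix.smul_apply,
    smul_eq_mul, mul_apply, Fin.sum_univ_three, of_apply, cons_val', cons_val_zero, cons_val_one,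
    cons_val]
  ring

/-- A case of the Cauchy–Binet formula, summed over all triples of columns. -/
lemma six_mul_det_mul_transpose {R m : Type*} [CommRing R] [Fintype m] (V : Matrix (Fin 3) m R) :
    6 * (V * Vᵀ).det = ∑ s, ∑ t, ∑ r, (V.submatrix id ![s, t, r]).det ^ 2 := by
  -- expansion of the determinant along products of entries in the columns `s`, `t`, `r`
  have key : ∀ a b c : Fin 3, ∑ s, ∑ t, ∑ r,
      V a s * V b t * V c r * (V.submatrix id ![s, t, r]).det =
      (of fun i j => (V * Vᵀ) (![a, b, c] i) j).det := by
    intro a b c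
    have h : ∀ s t r, V a s * V b t * V c r * (V.submatrix id ![s, t, r]).det =
        (V a s * V 0 s) * (V b t * V 1 t) * (V c r * V 2 r) -
        (V a s * V 0 s) * (V b t * V 2 t) * (V c r * V 1 r) -
        (V a s * V 1 s) * (V b t * V 0 t) * (V c r * V 2 r) +
        (V a s * V 1 s) * (V b t * V 2 t) * (V c r * V 0 r) +
        (V a s * V 2 s) * (V b t * V 0 t) * (V c r * V 1 r) -
        (V a s * V 2 s) * (V b t * V 1 t) * (V c r * V 0 r) := by
      intro s t r
      simp [det_fin_three]
      ring
    simp only [h, Finset.sum_add_distrib, Finset.sum_sub_distrib, ← Finset.mul_sum,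
      ← Finset.sum_mul]
    simp [det_fin_three, mul_apply]
  have hsq : ∀ s t r, (V.submatrix id ![s, t, r]).det ^ 2 =
      V 0 s * V 1 t * V 2 r * (V.submatrix id ![s, t, r]).det -
      V 0 s * V 2 t * V 1 r * (V.submatrix id ![s, t, r]).det -
      V 1 s * V 0 t * V 2 r * (V.submatrix id ![s, t, r]).det +
      V 1 s * V 2 t * V 0 r * (V.submatrix id ![s, t, r]).det +
      V 2 s * V 0 t * V 1 r * (V.submatrix id ![s, t, r]).det -
      V 2 s * V 1 t * V 0 r * (V.submatrix id ![s, t, r]).det := by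
    intro s t r
    rw [sq]
    nth_rewrite 1 [det_fin_three]
    simp only [submatrix_apply, id, cons_val_zero, cons_val_one, cons_val]
    ring
  simp only [hsq, Finset.sum_add_distrib, Finset.sum_sub_distrib, key]
  simp [det_fin_three]
  ring

/-- A symmetric matrix is determined by its quadratic form. -/
lemma eq_zero_of_quadratic_eq_zero {a : n → n → ℝ} (ha : ∀ i k, a i k = a k i)
    (h : ∀ x : n → ℝ, ∑ i, ∑ k, a i k * x i * x k = 0) (i k : n) : a i k = 0 := by
  have hd : ∀ i, a i i = 0 := fun i => by
    simpa [Pi.single_apply] using h (Pi.single i 1)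
  have h1 := h (Pi.single i 1 + Pi.single k 1)
  simp [Pi.single_apply, mul_add, Finset.sum_add_distrib, hd] at h1
  linarith [ha i k]

end RealMatrix

/-! ### Extremal polynomials -/

section Extremal

open MvPolynomial

/-- A summand of an extremal form in a sum of nonnegative forms is a multiple of it. -/
lemma exists_smul_of_add_eq {m n : ℕ} {P P₁ P₂ : MvPolynomial (Fin m) ℝ}
    (hP : P.IsHomogeneous (2 * n)) (hext : IsExtremalPolynomial P)
    (h₁ : P₁.IsHomogeneous (2 * n)) (h₂ : P₂.IsHomogeneous (2 * n))
    (h₁' : ∀ x, 0 ≤ eval x P₁) (h₂' : ∀ x, 0 ≤ eval x P₂) (h : P = P₁ + P₂) :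
    ∃ c : ℝ, P₁ = c • P := by
  obtain ⟨n', ⟨hn', hP0, -⟩, hno⟩ := hext
  obtain rfl : n' = n := by have := hn'.inj_right hP hP0; omega
  by_cases h10 : P₁ = 0
  · exact ⟨0, by simp [h10]⟩
  by_cases h20 : P₂ = 0
  · exact ⟨1, by simp [h, h20]⟩
  have hdep : ¬ LinearIndependent ℝ ![P₁, P₂] := fun hli =>
    hno ⟨P₁, P₂, ⟨h₁, h10, h₁'⟩, ⟨h₂, h20, h₂'⟩, hli, h⟩
  rw [LinearIndependent.pair_iff' h10] at hdep
  push Not at hdep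
  obtain ⟨a, rfl⟩ := hdep
  have ha : 1 + a ≠ 0 := by
    intro ha
    apply hP0
    have : P = (1 + a) • P₁ := by rw [h, add_smul, one_smul]
    rw [this, ha, zero_smul]
  refine ⟨(1 + a)⁻¹, ?_⟩
  rw [h, ← one_smul ℝ P₁, smul_smul, mul_one, ← add_smul, smul_smul, inv_mul_cancel₀ ha]

lemma exists_smul_of_sum_eq {m n : ℕ} {P : MvPolynomial (Fin m) ℝ}
    (hP : P.IsHomogeneous (2 * n)) (hext : IsExtremalPolynomial P) {ι : Type*} [Fintype ι]
    (f : ι → MvPolynomial (Fin m) ℝ) (hf : ∀ i, (f i).IsHomogeneous (2 * n))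
    (hf' : ∀ i x, 0 ≤ eval x (f i)) (h : P = ∑ i, f i) (i : ι) : ∃ c : ℝ, f i = c • P := by
  classical
  refine exists_smul_of_add_eq hP hext (hf i)
    (IsHomogeneous.sum _ _ _ fun j (_ : j ∈ Finset.univ.erase i) => hf j) (hf' i)
    (fun x => ?_) (h.trans (Finset.add_sum_erase _ _ (Finset.mem_univ i)).symm)
  rw [map_sum]
  exact Finset.sum_nonneg fun j _ => hf' j x

/-- If a positive multiple of an extremal form is a sum of squares times a nonnegative form `W`,
then, up to a factor, a single square suffices. -/
lemma exists_sq_mul_eq {m k l : ℕ} {P W : MvPolynomial (Fin m) ℝ}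
    (hP : P.IsHomogeneous (2 * (k + l))) (hext : IsExtremalPolynomial P) {c : ℝ} (hc : 0 < c)
    {ι : Type*} [Fintype ι] (q : ι → MvPolynomial (Fin m) ℝ) (hq : ∀ i, (q i).IsHomogeneous k)
    (hW : W.IsHomogeneous (2 * l)) (hW' : ∀ x, 0 ≤ eval x W)
    (h : (∑ i, q i ^ 2) * W = c • P) :
    ∃ p : MvPolynomial (Fin m) ℝ, p.IsHomogeneous k ∧ p ^ 2 * W = P := by
  have hP0 : P ≠ 0 := by obtain ⟨n, ⟨-, h0, -⟩, -⟩ := hext; exact h0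
  have hsum : P = ∑ i, c⁻¹ • (q i ^ 2 * W) := by
    rw [← Finset.smul_sum, ← Finset.sum_mul, h, smul_smul, inv_mul_cancel₀ hc.ne', one_smul]
  have hpos : ∀ i x, 0 ≤ eval x (c⁻¹ • (q i ^ 2 * W)) := fun i x => by
    rw [smul_eval, map_mul, map_pow]
    have := hW' x
    positivity
  have hmul := exists_smul_of_sum_eq hP hext (fun i => c⁻¹ • (q i ^ 2 * W)) (fun i => by
    rw [smul_eq_C_mul]
    refine IsHomogeneous.C_mul ?_ _
    have := ((hq i).pow 2).mul hW
    rwa [show k * 2 + 2 * l = 2 * (k + l) by ring] at this) hpos hsum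
  choose a ha using hmul
  obtain ⟨i, hi⟩ : ∃ i, a i ≠ 0 := by
    by_contra! hall
    apply hP0
    rw [hsum]
    exact Finset.sum_eq_zero fun i _ => by rw [ha, hall, zero_smul]
  have hai : 0 < a i := by
    obtain ⟨n, ⟨-, -, hPpos⟩, -⟩ := hext
    have hx : ∃ x, eval x P ≠ 0 := by
      by_contra! hall
      exact hP0 (MvPolynomial.funext fun x => by rw [hall, map_zero])
    obtain ⟨x, hx⟩ := hx
    have h1 := hpos i x
    rw [ha, smul_eval] at h1
    exact lt_of_le_of_ne (nonneg_of_mul_nonneg_left h1 ((hPpos x).lt_of_ne hx.symm)) hi.symm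
  refine ⟨C (Real.sqrt (c⁻¹ * (a i)⁻¹)) * q i, (hq i).C_mul _, ?_⟩
  have h2 : P = (a i)⁻¹ • (c⁻¹ • (q i ^ 2 * W)) := by
    rw [ha, smul_smul, inv_mul_cancel₀ hi, one_smul]
  rw [mul_pow, ← C_pow, Real.sq_sqrt (by positivity), mul_assoc, ← smul_eq_C_mul]
  conv_rhs => rw [h2, smul_smul]
  rw [mul_comm (a i)⁻¹]

end Extremal

/-! ### Tensors with the usual symmetries -/

namespace FourTensor

open Matrix

variable {d : ℕ}

/-- The acoustic tensor at a vector `y`, as a real matrix. -/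
def acousticAt (C : FourTensor d) (y : Fin d → ℝ) : Matrix (Fin d) (Fin d) ℝ :=
  Matrix.of fun i k => ∑ j, ∑ l, C i j k l * y j * y l

lemma acousticTensor_map_eval (C : FourTensor d) (y : Fin d → ℝ) :
    C.acousticTensor.map (MvPolynomial.eval y) = C.acousticAt y := by
  ext i k
  simp [acousticTensor, acousticAt]

lemma eval_acousticTensor (C : FourTensor d) (y : Fin d → ℝ) (i k : Fin d) :
    MvPolynomial.eval y (C.acousticTensor i k) = C.acousticAt y i k := by
  rw [← acousticTensor_map_eval]; rfl

lemma eval_det_acousticTensor (C : FourTensor d) (y : Fin d → ℝ) :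
    MvPolynomial.eval y C.acousticTensor.det = (C.acousticAt y).det := by
  rw [RingHom.map_det, ← acousticTensor_map_eval]; rfl

lemma eval_adjugate_acousticTensor (C : FourTensor d) (y : Fin d → ℝ) (i k : Fin d) :
    MvPolynomial.eval y (C.acousticTensor.adjugate i k) = (C.acousticAt y).adjugate i k := by
  have h := RingHom.map_adjugate (MvPolynomial.eval y) C.acousticTensor
  rw [RingHom.mapMatrix_apply, RingHom.mapMatrix_apply, acousticTensor_map_eval] at h
  rw [← h]; rfl

lemma form_vecMulVec (C : FourTensor d) (x y : Fin d → ℝ) :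
    C.form (vecMulVec x y) = ∑ i, ∑ k, C.acousticAt y i k * x i * x k := by
  simp only [form, acousticAt, vecMulVec_apply, of_apply, Finset.sum_mul]
  refine Finset.sum_congr rfl fun i _ => ?_
  rw [Finset.sum_comm]
  refine Finset.sum_congr rfl fun k _ => Finset.sum_congr rfl fun j _ =>
    Finset.sum_congr rfl fun l _ => ?_
  ring

lemma form_vecMulVec_eq_dotProduct (C : FourTensor d) (x y : Fin d → ℝ) :
    C.form (vecMulVec x y) = x ⬝ᵥ (C.acousticAt y *ᵥ x) := by
  simp only [form_vecMulVec, dotProduct, mulVec, Finset.mul_sum]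
  refine Finset.sum_congr rfl fun i _ => Finset.sum_congr rfl fun k _ => ?_
  ring

lemma HasUsualSymmetries.acousticTensor_symm {C : FourTensor d} (hC : C.HasUsualSymmetries)
    (i k : Fin d) : C.acousticTensor i k = C.acousticTensor k i := by
  simp only [acousticTensor, of_apply]
  refine Finset.sum_congr rfl fun j _ => Finset.sum_congr rfl fun l _ => ?_
  rw [(hC i j k l).1]

lemma HasUsualSymmetries.acousticAt_symm {C : FourTensor d} (hC : C.HasUsualSymmetries)
    (y : Fin d → ℝ) (i k : Fin d) : C.acousticAt y i k = C.acousticAt y k i := by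
  rw [← eval_acousticTensor, hC.acousticTensor_symm, eval_acousticTensor]

lemma HasUsualSymmetries.acousticAt_isHermitian {C : FourTensor d} (hC : C.HasUsualSymmetries)
    (y : Fin d → ℝ) : (C.acousticAt y).IsHermitian := by
  ext i k
  rw [conjTranspose_apply, star_trivial, hC.acousticAt_symm]

lemma HasUsualSymmetries.posSemidef_iff {C : FourTensor d} (hC : C.HasUsualSymmetries) :
    (∀ x y, 0 ≤ C.form (vecMulVec x y)) ↔ ∀ y, (C.acousticAt y).PosSemidef := by
  constructor
  · intro h y
    refine PosSemidef.of_dotProduct_mulVec_nonneg (hC.acousticAt_isHermitian y) fun x => ?_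
    rw [star_trivial, ← form_vecMulVec_eq_dotProduct]
    exact h x y
  · intro h x y
    rw [form_vecMulVec_eq_dotProduct]
    simpa using (h y).dotProduct_mulVec_nonneg x

/-- A tensor with the usual symmetries is determined by its biquadratic form. -/
lemma HasUsualSymmetries.eq_zero {C : FourTensor d} (hC : C.HasUsualSymmetries)
    (h : ∀ x y, C.form (vecMulVec x y) = 0) : C = 0 := by
  have h1 : ∀ y i k, C.acousticAt y i k = 0 := fun y => eq_zero_of_quadratic_eq_zero
    (hC.acousticAt_symm y) fun x => by rw [← form_vecMulVec, h]
  funext i j k l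
  exact eq_zero_of_quadratic_eq_zero (a := fun j l => C i j k l) (fun j l => (hC i j k l).2)
    (fun y => h1 y i k) j l

lemma HasUsualSymmetries.add {C D : FourTensor d} (hC : C.HasUsualSymmetries)
    (hD : D.HasUsualSymmetries) : HasUsualSymmetries (C + D) := fun i j k l => by
  simp only [Pi.add_apply]
  exact ⟨by rw [(hC i j k l).1, (hD i j k l).1], by rw [(hC i j k l).2, (hD i j k l).2]⟩

lemma HasUsualSymmetries.smul {C : FourTensor d} (hC : C.HasUsualSymmetries) (a : ℝ) :
    HasUsualSymmetries (a • C) := fun i j k l => by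
  simp only [Pi.smul_apply]
  exact ⟨by rw [(hC i j k l).1], by rw [(hC i j k l).2]⟩

lemma HasUsualSymmetries.sub {C D : FourTensor d} (hC : C.HasUsualSymmetries)
    (hD : D.HasUsualSymmetries) : HasUsualSymmetries (C - D) := fun i j k l => by
  simp only [Pi.sub_apply]
  exact ⟨by rw [(hC i j k l).1, (hD i j k l).1], by rw [(hC i j k l).2, (hD i j k l).2]⟩

lemma form_add (C D : FourTensor d) : form (C + D) = C.form + D.form := by
  funext ξ
  simp [form, add_mul, Finset.sum_add_distrib]

lemma form_sub (C D : FourTensor d) : form (C - D) = C.form - D.form := by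
  funext ξ
  simp [form, sub_mul, Finset.sum_sub_distrib]

lemma form_smul (a : ℝ) (C : FourTensor d) : form (a • C) = a • C.form := by
  funext ξ
  simp [form, Finset.mul_sum, mul_assoc]

lemma acousticTensor_add (C D : FourTensor d) :
    acousticTensor (C + D) = C.acousticTensor + D.acousticTensor := by
  ext1 i k
  simp [acousticTensor, add_mul, Finset.sum_add_distrib]

lemma acousticTensor_sub (C D : FourTensor d) :
    acousticTensor (C - D) = C.acousticTensor - D.acousticTensor := by
  ext1 i k
  simp [acousticTensor, sub_mul, Finset.sum_sub_distrib]

lemma acousticTensor_smul (a : ℝ) (C : FourTensor d) :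
    acousticTensor (a • C) = a • C.acousticTensor := by
  ext1 i k
  simp [acousticTensor, Finset.smul_sum, MvPolynomial.smul_eq_C_mul, mul_assoc]

lemma isHomogeneous_acousticTensor (C : FourTensor d) (i k : Fin d) :
    (C.acousticTensor i k).IsHomogeneous 2 := by
  simp only [acousticTensor, of_apply]
  refine MvPolynomial.IsHomogeneous.sum _ _ _ fun j _ =>
    MvPolynomial.IsHomogeneous.sum _ _ _ fun l _ => ?_
  exact (MvPolynomial.isHomogeneous_C_mul_X _ _).mul (MvPolynomial.isHomogeneous_X _ _)

lemma continuous_form_vecMulVec (C : FourTensor d) (x : Fin d → ℝ) :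
    Continuous fun y => C.form (vecMulVec x y) := by
  unfold form vecMulVec
  simp only [of_apply]
  fun_prop

lemma isHomogeneous_adjugate {A : Matrix (Fin 3) (Fin 3) (MvPolynomial (Fin 3) ℝ)}
    (hA : ∀ i k, (A i k).IsHomogeneous 2) (i k : Fin 3) : (A.adjugate i k).IsHomogeneous 4 := by
  have h : ∀ M : Matrix (Fin 2) (Fin 2) (MvPolynomial (Fin 3) ℝ),
      (∀ i k, (M i k).IsHomogeneous 2) → M.det.IsHomogeneous 4 := fun M hM => by
    rw [det_fin_two]
    exact ((hM 0 0).mul (hM 1 1)).sub ((hM 0 1).mul (hM 1 0))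
  have hm := h (A.submatrix k.succAbove i.succAbove) fun _ _ => hA _ _
  rw [adjugate_fin_succ_eq_det_submatrix]
  rcases neg_one_pow_eq_or (MvPolynomial (Fin 3) ℝ) (k + i : ℕ) with h1 | h1 <;> rw [h1]
  · rwa [one_mul]
  · rw [neg_one_mul]
    exact hm.neg

lemma isHomogeneous_det {A : Matrix (Fin 3) (Fin 3) (MvPolynomial (Fin 3) ℝ)}
    (hA : ∀ i k, (A i k).IsHomogeneous 2) : A.det.IsHomogeneous 6 := by
  rw [det_eq_sum_mul_adjugate_row A 0]
  exact MvPolynomial.IsHomogeneous.sum _ _ _ fun j _ => (hA 0 j).mul (isHomogeneous_adjugate hA j 0)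

lemma isHomogeneous_trace_adjugate_mul {A B : Matrix (Fin 3) (Fin 3) (MvPolynomial (Fin 3) ℝ)}
    (hA : ∀ i k, (A i k).IsHomogeneous 2) (hB : ∀ i k, (B i k).IsHomogeneous 2) :
    (A.adjugate * B).trace.IsHomogeneous 6 := by
  simp only [trace, diag_apply, mul_apply]
  exact MvPolynomial.IsHomogeneous.sum _ _ _ fun _ _ => MvPolynomial.IsHomogeneous.sum _ _ _
    fun _ _ => (isHomogeneous_adjugate hA _ _).mul (hB _ _)

lemma eval_trace_adjugate_mul (C D : FourTensor d) (y : Fin d → ℝ) :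
    MvPolynomial.eval y (C.acousticTensor.adjugate * D.acousticTensor).trace =
      ((C.acousticAt y).adjugate * D.acousticAt y).trace := by
  simp only [trace, diag_apply, mul_apply, map_sum, map_mul, eval_adjugate_acousticTensor,
    eval_acousticTensor]

end FourTensor

/-! ### Sums of squares and polyconvexity -/

section SumOfSquares

open Matrix FourTensor

variable {d : ℕ}

/-- The bilinear form `∑ B_ij x_i y_j`. -/
def bilinearValue (B : Matrix (Fin d) (Fin d) ℝ) (x y : Fin d → ℝ) : ℝ :=
  ∑ i, ∑ j, B i j * x i * y j

lemma isBiquadraticSumOfSquares_iff {f : Matrix (Fin d) (Fin d) ℝ → ℝ} :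
    IsBiquadraticSumOfSquares f ↔ ∃ L : List (Matrix (Fin d) (Fin d) ℝ), ∀ x y,
      f (vecMulVec x y) = (L.map fun B => bilinearValue B x y ^ 2).sum := by
  constructor
  · rintro ⟨m, B, hB⟩
    refine ⟨List.ofFn B, fun x y => ?_⟩
    rw [hB, List.map_ofFn, List.sum_ofFn]
    rfl
  · rintro ⟨L, hL⟩
    refine ⟨L.length, fun i => L[i], fun x y => ?_⟩
    rw [hL, ← Fin.sum_univ_fun_getElem]
    rfl

lemma IsBiquadraticSumOfSquares.add {f g : Matrix (Fin d) (Fin d) ℝ → ℝ}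
    (hf : IsBiquadraticSumOfSquares f) (hg : IsBiquadraticSumOfSquares g) :
    IsBiquadraticSumOfSquares (f + g) := by
  rw [isBiquadraticSumOfSquares_iff] at *
  obtain ⟨L, hL⟩ := hf
  obtain ⟨M, hM⟩ := hg
  exact ⟨L ++ M, fun x y => by simp [hL, hM]⟩

lemma IsBiquadraticSumOfSquares.smul {f : Matrix (Fin d) (Fin d) ℝ → ℝ}
    (hf : IsBiquadraticSumOfSquares f) {a : ℝ} (ha : 0 ≤ a) :
    IsBiquadraticSumOfSquares (a • f) := by
  obtain ⟨m, B, hB⟩ := hf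
  refine ⟨m, fun s => Real.sqrt a • B s, fun x y => ?_⟩
  have h : ∀ s, ∑ i, ∑ j, (Real.sqrt a • B s) i j * x i * y j =
      Real.sqrt a * ∑ i, ∑ j, B s i j * x i * y j := fun s => by
    simp [Finset.mul_sum, mul_assoc]
  simp only [h, mul_pow, Real.sq_sqrt ha, ← Finset.mul_sum, ← hB]
  rfl

/-- The `2 × 2` minors, for arbitrary pairs of rows and of columns, are linear in the vector of
minors. -/
lemma exists_linear_minor (i j k l : Fin d) : ∃ M : (MinorIndex d → ℝ) →ₗ[ℝ] ℝ,
    ∀ ξ : Matrix (Fin d) (Fin d) ℝ, M (minors ξ) = ξ i j * ξ k l - ξ k j * ξ i l := by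
  have main : ∀ i j k l : Fin d, i < k → j < l → ∃ M : (MinorIndex d → ℝ) →ₗ[ℝ] ℝ,
      ∀ ξ : Matrix (Fin d) (Fin d) ℝ, M (minors ξ) = ξ i j * ξ k l - ξ k j * ξ i l := by
    intro i j k l hik hjl
    have hd : 1 < d := by have := i.2; have := k.2; omega
    have hmono : ∀ a b : Fin d, a < b → StrictMono (![a, b] : Fin (1 + 1) → Fin d) := by
      intro a b hab p q hpq
      fin_cases p <;> fin_cases q <;> simp_all
    refine ⟨LinearMap.proj ⟨⟨1, hd⟩, OrderEmbedding.ofStrictMono _ (hmono i k hik),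
      OrderEmbedding.ofStrictMono _ (hmono j l hjl)⟩, fun ξ => ?_⟩
    change (ξ.submatrix ![i, k] ![j, l]).det = _
    rw [det_fin_two]
    simp
    ring
  have hneg : ∀ i j k l : Fin d, i < k → ∃ M : (MinorIndex d → ℝ) →ₗ[ℝ] ℝ,
      ∀ ξ : Matrix (Fin d) (Fin d) ℝ, M (minors ξ) = ξ i j * ξ k l - ξ k j * ξ i l := by
    intro i j k l hik
    rcases lt_trichotomy j l with h | rfl | h
    · exact main i j k l hik h
    · exact ⟨0, fun ξ => by simp; ring⟩
    · obtain ⟨M, hM⟩ := main i l k j hik h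
      exact ⟨-M, fun ξ => by rw [LinearMap.neg_apply, hM]; ring⟩
  rcases lt_trichotomy i k with h | rfl | h
  · exact hneg i j k l h
  · exact ⟨0, fun ξ => by simp⟩
  · obtain ⟨M, hM⟩ := hneg k j i l h
    exact ⟨-M, fun ξ => by rw [LinearMap.neg_apply, hM]; ring⟩

lemma exists_linear_entry (i j : Fin d) : ∃ N : (MinorIndex d → ℝ) →ₗ[ℝ] ℝ,
    ∀ ξ : Matrix (Fin d) (Fin d) ℝ, N (minors ξ) = ξ i j := by
  have hd : 0 < d := i.pos
  have hmono : ∀ a : Fin d, StrictMono (fun _ => a : Fin (0 + 1) → Fin d) :=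
    fun a p q hpq => by
      have := p.2; have := q.2; rw [Fin.lt_def] at hpq; omega
  refine ⟨LinearMap.proj ⟨⟨0, hd⟩, OrderEmbedding.ofStrictMono _ (hmono i),
    OrderEmbedding.ofStrictMono _ (hmono j)⟩, fun ξ => ?_⟩
  change (ξ.submatrix (fun _ : Fin 1 => i) (fun _ => j)).det = _
  rw [det_fin_one]
  rfl

/-- If the biquadratic form is a sum of squares then the quadratic form differs from a sum of
squares of linear forms by a combination of `2 × 2` minors, so it is polyconvex. -/
lemma isPolyconvex_of_isBiquadraticSumOfSquares {C : FourTensor d} (hC : C.HasUsualSymmetries)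
    (h : IsBiquadraticSumOfSquares C.form) : IsPolyconvex C.form := by
  obtain ⟨m, B, hB⟩ := h
  let E : FourTensor d := fun i j k l => ∑ s, (1 / 2) * (B s i j * B s k l + B s k j * B s i l)
  have hE : E.HasUsualSymmetries := fun i j k l =>
    ⟨Finset.sum_congr rfl fun s _ => by ring, Finset.sum_congr rfl fun s _ => by ring⟩
  choose M hM using fun i j k l : Fin d => exists_linear_minor i j k l
  choose N hN using fun i j : Fin d => exists_linear_entry i j
  let G : Fin m → (MinorIndex d → ℝ) →ₗ[ℝ] ℝ := fun s => ∑ i, ∑ j, B s i j • N i j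
  let K : (MinorIndex d → ℝ) →ₗ[ℝ] ℝ :=
    ∑ s, ∑ i, ∑ j, ∑ k, ∑ l, (1 / 2 * (B s k j * B s i l)) • M i j k l
  have hG : ∀ s ξ, G s (minors ξ) = ∑ i, ∑ j, B s i j * ξ i j := fun s ξ => by
    simp [G, LinearMap.sum_apply, hN]
  have hform : ∀ ξ, E.form ξ = ∑ s, (∑ i, ∑ j, B s i j * ξ i j) ^ 2 + K (minors ξ) := by
    intro ξ
    have hsw : ∀ t : Fin d → Fin d → Fin d → Fin d → ℝ,
        ∑ i, ∑ j, ∑ k, ∑ l, t i j k l = ∑ i, ∑ j, ∑ k, ∑ l, t k j i l := fun t => by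
      rw [Finset.sum_comm]
      conv_rhs => rw [Finset.sum_comm]
      exact Finset.sum_congr rfl fun j _ => Finset.sum_comm
    have hE' : E.form ξ = ∑ s, ∑ i, ∑ j, ∑ k, ∑ l,
        (1 / 2) * (B s i j * B s k l + B s k j * B s i l) * ξ i j * ξ k l := by
      simp only [form, E, Finset.sum_mul]
      symm
      rw [Finset.sum_comm]; refine Finset.sum_congr rfl fun i _ => ?_
      rw [Finset.sum_comm]; refine Finset.sum_congr rfl fun j _ => ?_
      rw [Finset.sum_comm]; refine Finset.sum_congr rfl fun k _ => ?_
      rw [Finset.sum_comm]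
    simp only [hE', K, LinearMap.sum_apply, LinearMap.smul_apply, hM, smul_eq_mul,
      ← Finset.sum_add_distrib]
    refine Finset.sum_congr rfl fun s _ => ?_
    have h1 := hsw fun i j k l => B s i j * ξ i j * (B s k l * ξ k l)
    have h2 : (∑ i, ∑ j, B s i j * ξ i j) ^ 2 =
        ∑ i, ∑ j, ∑ k, ∑ l, B s i j * ξ i j * (B s k l * ξ k l) := by
      rw [sq]
      simp only [Finset.sum_mul]
      simp only [Finset.mul_sum]
    have h3 : (∑ i, ∑ j, B s i j * ξ i j) ^ 2 =
        ∑ i, ∑ j, ∑ k, ∑ l, ((1 / 2) * (B s i j * ξ i j * (B s k l * ξ k l)) +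
          (1 / 2) * (B s k j * ξ k j * (B s i l * ξ i l))) := by
      have ha : (1 / 2) * (∑ i, ∑ j, B s i j * ξ i j) ^ 2 =
          ∑ i, ∑ j, ∑ k, ∑ l, (1 / 2) * (B s i j * ξ i j * (B s k l * ξ k l)) := by
        rw [h2]
        simp only [Finset.mul_sum]
      have hb : (1 / 2) * (∑ i, ∑ j, B s i j * ξ i j) ^ 2 =
          ∑ i, ∑ j, ∑ k, ∑ l, (1 / 2) * (B s k j * ξ k j * (B s i l * ξ i l)) := by
        rw [h2, h1]
        simp only [Finset.mul_sum]
      simp only [Finset.sum_add_distrib]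
      rw [← ha, ← hb]
      ring
    rw [h3]
    simp only [← Finset.sum_add_distrib]
    refine Finset.sum_congr rfl fun i _ => Finset.sum_congr rfl fun j _ =>
      Finset.sum_congr rfl fun k _ => Finset.sum_congr rfl fun l _ => ?_
    ring
  have hCE : C = E := by
    refine sub_eq_zero.mp ((hC.sub hE).eq_zero fun x y => ?_)
    have hK : K (minors (vecMulVec x y)) = 0 := by
      simp only [K, LinearMap.sum_apply, LinearMap.smul_apply, hM, vecMulVec_apply, smul_eq_mul]
      refine Finset.sum_eq_zero fun s _ => Finset.sum_eq_zero fun i _ => Finset.sum_eq_zero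
        fun j _ => Finset.sum_eq_zero fun k _ => Finset.sum_eq_zero fun l _ => ?_
      ring
    rw [form_sub, Pi.sub_apply, hform, hK, hB]
    simp only [vecMulVec_apply, mul_assoc, add_zero, sub_self]
  refine ⟨fun v => ∑ s, G s v ^ 2 + K v, ?_, fun ξ => ?_⟩
  · refine ConvexOn.add ?_ (K.convexOn convex_univ)
    have hs : ∀ t : Finset (Fin m), ConvexOn ℝ Set.univ fun v => ∑ s ∈ t, G s v ^ 2 := by
      classical
      intro t
      induction t using Finset.induction_on with
      | empty => simpa using convexOn_const 0 convex_univ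
      | insert s t hst ih =>
        simp only [Finset.sum_insert hst]
        have h := (even_two.convexOn_pow (𝕜 := ℝ)).comp_linearMap (G s)
        rw [Set.preimage_univ] at h
        exact h.add ih
    exact hs _
  · rw [hCE, hform]
    simp only [hG]

end SumOfSquares

/-! ### Criteria for sums of squares -/

section SumOfSquares

open Matrix FourTensor

variable {d : ℕ}

lemma isBiquadraticSumOfSquares_of_eq_sum {f : Matrix (Fin d) (Fin d) ℝ → ℝ} {ι : Type*}
    [Fintype ι] (c : ι → ℝ) (hc : ∀ i, 0 ≤ c i) (B : ι → Matrix (Fin d) (Fin d) ℝ)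
    (h : ∀ x y, f (vecMulVec x y) = ∑ i, c i * bilinearValue (B i) x y ^ 2) :
    IsBiquadraticSumOfSquares f := by
  classical
  let e := Fintype.equivFin ι
  refine ⟨Fintype.card ι, fun s => Real.sqrt (c (e.symm s)) • B (e.symm s), fun x y => ?_⟩
  rw [h, ← e.symm.sum_comp]
  refine Finset.sum_congr rfl fun s _ => ?_
  have h2 : ∑ i, ∑ j, (Real.sqrt (c (e.symm s)) • B (e.symm s)) i j * x i * y j =
      Real.sqrt (c (e.symm s)) * bilinearValue (B (e.symm s)) x y := by
    simp [bilinearValue, Finset.mul_sum, mul_assoc]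
  rw [h2, mul_pow, Real.sq_sqrt (hc _)]

lemma isBiquadraticSumOfSquares_of_eq_zero {f : Matrix (Fin d) (Fin d) ℝ → ℝ}
    (h : ∀ x y, f (vecMulVec x y) = 0) : IsBiquadraticSumOfSquares f :=
  isBiquadraticSumOfSquares_of_eq_sum (ι := Fin 0) (fun _ => 0) (fun _ => le_rfl) (fun _ => 0)
    fun x y => by simp [h]

lemma bilinearValue_vecMulVec (v w x y : Fin d → ℝ) :
    bilinearValue (vecMulVec v w) x y = (v ⬝ᵥ x) * (w ⬝ᵥ y) := by
  simp only [bilinearValue, dotProduct, vecMulVec_apply, Finset.sum_mul]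
  simp only [Finset.mul_sum]
  refine Finset.sum_congr rfl fun i _ => Finset.sum_congr rfl fun j _ => ?_
  ring

/-- A nonnegative quadratic form is a sum of squares of linear forms. -/
lemma exists_sum_sq_of_quadratic_nonneg {N : Matrix (Fin d) (Fin d) ℝ}
    (hN : ∀ i k, N i k = N k i) (h : ∀ y : Fin d → ℝ, 0 ≤ ∑ j, ∑ l, N j l * y j * y l) :
    ∃ (m : ℕ) (v : Fin m → Fin d → ℝ), ∀ y : Fin d → ℝ,
      ∑ j, ∑ l, N j l * y j * y l = ∑ s, (v s ⬝ᵥ y) ^ 2 := by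
  have hq : ∀ (M : Matrix (Fin d) (Fin d) ℝ) (y : Fin d → ℝ),
      y ⬝ᵥ (M *ᵥ y) = ∑ j, ∑ l, M j l * y j * y l := fun M y => by
    simp only [dotProduct, mulVec, Finset.mul_sum]
    refine Finset.sum_congr rfl fun i _ => Finset.sum_congr rfl fun j _ => ?_
    ring
  have hpsd : N.PosSemidef := PosSemidef.of_dotProduct_mulVec_nonneg
    (by ext i k; rw [conjTranspose_apply, star_trivial, hN])
    fun y => by rw [star_trivial, hq]; exact h y
  obtain ⟨m, v, rfl⟩ := posSemidef_iff_eq_sum_vecMulVec.mp hpsd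
  refine ⟨m, v, fun y => ?_⟩
  rw [← hq, sum_mulVec, dotProduct_sum]
  refine Finset.sum_congr rfl fun s _ => ?_
  rw [star_trivial, vecMulVec_mulVec, dotProduct_smul, dotProduct_comm y]
  simp [sq]

end SumOfSquares

/-! ### Quadratic forms as polynomials -/

namespace MvPolynomial

lemma eval_comp_map {σ R S : Type*} [CommRing R] [CommRing S] (f : R →+* S) (y : σ → R)
    (p : MvPolynomial σ R) : eval (f ∘ y) (map f p) = f (eval y p) := by
  induction p using MvPolynomial.induction_on with
  | C a => simp
  | add p q hp hq => simp [hp, hq]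
  | mul_X p i hp => simp [hp]

lemma IsHomogeneous.exists_quadratic {n : ℕ} {p : MvPolynomial (Fin n) ℝ}
    (hp : p.IsHomogeneous 2) : ∃ N : Matrix (Fin n) (Fin n) ℝ, (∀ j l, N j l = N l j) ∧
      ∀ y, eval y p = ∑ j, ∑ l, N j l * y j * y l := by
  rw [← mem_homogeneousSubmodule, ← homogeneousSubmodule_one_pow, sq] at hp
  induction hp using Submodule.mul_induction_on' with
  | mem_mul_mem p hp q hq =>
    obtain ⟨c, hc⟩ := IsHomogeneous.eval_of_degree_one hp
    obtain ⟨e, he⟩ := IsHomogeneous.eval_of_degree_one hq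
    refine ⟨fun j l => (c j * e l + c l * e j) / 2, fun j l => by ring, fun y => ?_⟩
    have h1 : (∑ i, c i * y i) * (∑ i, e i * y i) =
        ∑ j, ∑ l, c j * y j * (e l * y l) := by
      simp only [Finset.sum_mul]
      simp only [Finset.mul_sum]
    have h2 := h1
    rw [Finset.sum_comm] at h2
    have h3 : ∀ j l, (c j * e l + c l * e j) / 2 * y j * y l =
        (1 / 2) * (c j * y j * (e l * y l)) + (1 / 2) * (c l * y l * (e j * y j)) :=
      fun j l => by ring
    simp only [h3, Finset.sum_add_distrib, ← Finset.mul_sum] at h1 h2 ⊢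
    rw [map_mul, hc, he]
    simp only [← Finset.sum_mul, ← Finset.mul_sum]
    ring
  | add p _ q _ hp hq =>
    obtain ⟨M, hM, hM'⟩ := hp
    obtain ⟨N, hN, hN'⟩ := hq
    exact ⟨M + N, fun j l => by rw [Matrix.add_apply, Matrix.add_apply, hM, hN],
      fun y => by simp [hM', hN', add_mul, Finset.sum_add_distrib]⟩

/-- A nonnegative form of degree two is a sum of squares of linear forms. -/
lemma IsHomogeneous.exists_sum_sq {n : ℕ} {p : MvPolynomial (Fin n) ℝ}
    (hp : p.IsHomogeneous 2) (h : ∀ y, 0 ≤ eval y p) :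
    ∃ (m : ℕ) (l : Fin m → MvPolynomial (Fin n) ℝ), (∀ s, (l s).IsHomogeneous 1) ∧
      p = ∑ s, l s ^ 2 := by
  obtain ⟨N, hN, hN'⟩ := hp.exists_quadratic
  obtain ⟨m, v, hv⟩ := exists_sum_sq_of_quadratic_nonneg hN fun y => by rw [← hN']; exact h y
  refine ⟨m, fun s => ∑ j, C (v s j) * X j, fun s =>
    IsHomogeneous.sum _ _ _ fun j _ => isHomogeneous_C_mul_X _ _, MvPolynomial.funext fun y => ?_⟩
  rw [hN', hv]
  simp [dotProduct]

end MvPolynomial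

/-! ### Rank-one matrices of size three -/

section KeyLemma

open Matrix FourTensor

/-- The matrix of the cross product with `u`. -/
def crossMatrix {R : Type*} [CommRing R] (u : Fin 3 → R) : Matrix (Fin 3) (Fin 3) R :=
  !![0, -u 2, u 1; u 2, 0, -u 0; -u 1, u 0, 0]

/-- If `A` is symmetric, `adj A = u uᵀ` and `A u = 0`, then the Hermitian matrix
`A + i (u × ·)` has rank one; these are the real and the imaginary part of this statement. -/
lemma add_crossMatrix_rank_one {R : Type*} [CommRing R] {A : Matrix (Fin 3) (Fin 3) R}
    (hA : ∀ j k, A j k = A k j) {u : Fin 3 → R} (hadj : ∀ j k, A.adjugate j k = u j * u k)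
    (hu : ∀ j, ∑ k, A j k * u k = 0) (i j k : Fin 3) :
    A i i * A j k = A j i * A i k - crossMatrix u j i * crossMatrix u i k ∧
    A i i * crossMatrix u j k = A j i * crossMatrix u i k + crossMatrix u j i * A i k := by
  have h10 := hA 1 0
  have h20 := hA 2 0
  have h21 := hA 2 1
  have a00 := hadj 0 0
  have a01 := hadj 0 1
  have a02 := hadj 0 2
  have a11 := hadj 1 1
  have a12 := hadj 1 2
  have a22 := hadj 2 2
  have u0 := hu 0
  have u1 := hu 1
  have u2 := hu 2
  simp only [adjugate_fin_three, of_apply, cons_val', cons_val_zero, cons_val_one, cons_val,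
    cons_val_fin_one, Fin.sum_univ_three, h10, h20, h21] at a00 a01 a02 a11 a12 a22 u0 u1 u2
  clear hadj hu hA
  fin_cases i <;> fin_cases j <;> fin_cases k <;>
    simp only [crossMatrix, Fin.zero_eta, Fin.mk_one, Fin.reduceFinMk, of_apply, cons_val',
      cons_val_zero, cons_val_one, cons_val, cons_val_fin_one, h10, h20, h21] <;>
    constructor <;> grind

lemma rank_one_of_adjugate_eq_zero {R : Type*} [CommRing R] {N : Matrix (Fin 3) (Fin 3) R}
    (h : N.adjugate = 0) (i j k : Fin 3) : N i i * N j k = N j i * N i k := by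
  have a : ∀ p q, N.adjugate p q = 0 := fun p q => by rw [h]; rfl
  have a00 := a 0 0
  have a01 := a 0 1
  have a02 := a 0 2
  have a10 := a 1 0
  have a11 := a 1 1
  have a12 := a 1 2
  have a20 := a 2 0
  have a21 := a 2 1
  have a22 := a 2 2
  simp only [adjugate_fin_three, of_apply, cons_val', cons_val_zero, cons_val_one, cons_val,
    cons_val_fin_one] at a00 a01 a02 a10 a11 a12 a20 a21 a22
  clear a h
  fin_cases i <;> fin_cases j <;> fin_cases k <;>
    simp only [Fin.zero_eta, Fin.mk_one, Fin.reduceFinMk] <;> grind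

end KeyLemma

/-! ### Forms whose acoustic tensor has adjugate `u uᵀ` -/

section KeyLemma

open Matrix FourTensor

/-- Evaluation at a real point commutes with conjugation of the coefficients. -/
lemma eval_map_conj (y : Fin 3 → ℝ) (p : MvPolynomial (Fin 3) ℂ) :
    MvPolynomial.eval (Complex.ofRealHom ∘ y) (MvPolynomial.map (starRingEnd ℂ) p) =
      starRingEnd ℂ (MvPolynomial.eval (Complex.ofRealHom ∘ y) p) := by
  rw [← MvPolynomial.eval_comp_map]
  congr 2
  funext i
  simp

/-- A nonnegative biquadratic form `|q(x, y)|² Re g(y)` with forms `g` and `q`, where `q` is linear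
in `x`, is a sum of squares: by degree either `q` is bilinear and `g` is constant, or `q` does not
involve `y` and `g` is a quadratic form. -/
lemma isBiquadraticSumOfSquares_of_factor {C : FourTensor 3} (hC : C.HasUsualSymmetries)
    (hpos : ∀ x y, 0 ≤ C.form (vecMulVec x y)) {a b : ℕ} (hab : a + 2 * b = 2)
    {g : MvPolynomial (Fin 3) ℂ} {q : Fin 3 → MvPolynomial (Fin 3) ℂ}
    (hg : g.IsHomogeneous a) (hq : ∀ k, (q k).IsHomogeneous b)
    (h : ∀ x y : Fin 3 → ℝ, C.form (vecMulVec x y) =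
      (MvPolynomial.eval (Complex.ofRealHom ∘ y) g).re *
        Complex.normSq (∑ k, MvPolynomial.eval (Complex.ofRealHom ∘ y) (q k) * x k)) :
    IsBiquadraticSumOfSquares C.form := by
  obtain ⟨rfl, rfl⟩ | ⟨rfl, rfl⟩ : (a = 0 ∧ b = 1) ∨ (a = 2 ∧ b = 0) := by omega
  · obtain ⟨c, rfl⟩ := hg.eq_C_of_degree_zero
    choose w hw using fun k => (hq k).eval_of_degree_one
    have hval : ∀ x y : Fin 3 → ℝ, C.form (vecMulVec x y) =
        c.re * bilinearValue (of fun k j => (w k j).re) x y ^ 2 +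
        c.re * bilinearValue (of fun k j => (w k j).im) x y ^ 2 := by
      intro x y
      have hre : (∑ k, MvPolynomial.eval (Complex.ofRealHom ∘ y) (q k) * (x k : ℂ)).re =
          bilinearValue (of fun k j => (w k j).re) x y := by
        simp only [hw, bilinearValue, of_apply, Complex.re_sum, Complex.mul_re,
          Function.comp_apply, Complex.ofRealHom_eq_coe, Complex.ofReal_re, Complex.ofReal_im,
          mul_zero, sub_zero, Finset.sum_mul]
        simp only [mul_right_comm _ (y _) (x _)]
      have him : (∑ k, MvPolynomial.eval (Complex.ofRealHom ∘ y) (q k) * (x k : ℂ)).im =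
          bilinearValue (of fun k j => (w k j).im) x y := by
        simp only [hw, bilinearValue, of_apply, Complex.im_sum, Complex.mul_im,
          Function.comp_apply, Complex.ofRealHom_eq_coe, Complex.ofReal_re, Complex.ofReal_im,
          mul_zero, zero_add, Finset.sum_mul]
        simp only [mul_right_comm _ (y _) (x _)]
      rw [h, Complex.normSq_apply, hre, him, MvPolynomial.eval_C]
      ring
    rcases le_or_gt 0 c.re with hc | hc
    · exact isBiquadraticSumOfSquares_of_eq_sum (ι := Fin 2) (fun _ => c.re) (fun _ => hc)
        ![of fun k j => (w k j).re, of fun k j => (w k j).im] fun x y => by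
          simp [hval, Fin.sum_univ_two]
    · refine isBiquadraticSumOfSquares_of_eq_zero fun x y => le_antisymm ?_ (hpos x y)
      rw [hval]
      nlinarith [sq_nonneg (bilinearValue (of fun k j => (w k j).re) x y),
        sq_nonneg (bilinearValue (of fun k j => (w k j).im) x y)]
  · choose w hw using fun k => (hq k).eq_C_of_degree_zero
    simp only [hw, MvPolynomial.eval_C] at h
    by_cases hx : ∃ x₀ : Fin 3 → ℝ, Complex.normSq (∑ k, w k * x₀ k) ≠ 0
    · obtain ⟨x₀, hx₀⟩ := hx
      have hx₀' : 0 < Complex.normSq (∑ k, w k * x₀ k) := (Complex.normSq_nonneg _).lt_of_ne' hx₀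
      -- the factor `g` is a quadratic form, which is read off at the vector `x₀`
      let N : Matrix (Fin 3) (Fin 3) ℝ := of fun j l => ∑ i, ∑ k, C i j k l * x₀ i * x₀ k
      have hN : ∀ y : Fin 3 → ℝ, ∑ j, ∑ l, N j l * y j * y l = C.form (vecMulVec x₀ y) := by
        intro y
        simp only [N, form, of_apply, vecMulVec_apply, Finset.sum_mul]
        calc ∑ j, ∑ l, ∑ i, ∑ k, C i j k l * x₀ i * x₀ k * y j * y l
            = ∑ j, ∑ i, ∑ k, ∑ l, C i j k l * x₀ i * x₀ k * y j * y l := by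
              refine Finset.sum_congr rfl fun j _ => ?_
              rw [Finset.sum_comm]
              exact Finset.sum_congr rfl fun i _ => Finset.sum_comm
          _ = _ := by
              rw [Finset.sum_comm]
              refine Finset.sum_congr rfl fun i _ => Finset.sum_congr rfl fun j _ =>
                Finset.sum_congr rfl fun k _ => Finset.sum_congr rfl fun l _ => ?_
              ring
      obtain ⟨m, v, hv⟩ := exists_sum_sq_of_quadratic_nonneg (N := N)
        (fun j l => by
          simp only [N, of_apply]
          exact Finset.sum_congr rfl fun i _ => Finset.sum_congr rfl fun k _ => by
            rw [(hC i j k l).2]) fun y => by rw [hN]; exact hpos _ _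
      refine isBiquadraticSumOfSquares_of_eq_sum (ι := Fin m ⊕ Fin m)
        (fun _ => (Complex.normSq (∑ k, w k * x₀ k))⁻¹) (fun _ => by positivity)
        (Sum.elim (fun s => vecMulVec (fun k => (w k).re) (v s))
          (fun s => vecMulVec (fun k => (w k).im) (v s))) fun x y => ?_
      have h1 : (MvPolynomial.eval (Complex.ofRealHom ∘ y) g).re =
          (Complex.normSq (∑ k, w k * x₀ k))⁻¹ * ∑ s, (v s ⬝ᵥ y) ^ 2 := by
        rw [← hv, hN, h]
        field_simp
      have hre : (∑ k, w k * (x k : ℂ)).re = (fun k => (w k).re) ⬝ᵥ x := by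
        simp [dotProduct]
      have him : (∑ k, w k * (x k : ℂ)).im = (fun k => (w k).im) ⬝ᵥ x := by
        simp [dotProduct]
      rw [h, h1, Complex.normSq_apply (∑ k, w k * (x k : ℂ)), hre, him]
      simp only [Fintype.sum_sum_type, Sum.elim_inl, Sum.elim_inr, bilinearValue_vecMulVec, mul_pow,
        ← Finset.mul_sum]
      ring
    · push Not at hx
      exact isBiquadraticSumOfSquares_of_eq_zero fun x y => by rw [h, hx, mul_zero]

/-- If the adjugate of the acoustic tensor is `u uᵀ` then the biquadratic form is a sum of squares.
The acoustic tensor plus `i` times the cross product with `u` is a Hermitian matrix of rank one over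
`ℂ[y]`, hence of the form `g * q* q`. -/
lemma isBiquadraticSumOfSquares_of_adjugate_eq {C : FourTensor 3} (hC : C.HasUsualSymmetries)
    (hpos : ∀ x y, 0 ≤ C.form (vecMulVec x y)) (hdet : C.acousticTensor.det = 0)
    {u : Fin 3 → MvPolynomial (Fin 3) ℝ} (hu : ∀ k, (u k).IsHomogeneous 2)
    (hadj : ∀ j k, C.acousticTensor.adjugate j k = u j * u k) :
    IsBiquadraticSumOfSquares C.form := by
  set A := C.acousticTensor with hA
  have hsymm : ∀ j k, A j k = A k j := hC.acousticTensor_symm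
  by_cases hdiag : ∀ i, A i i = 0
  · refine isBiquadraticSumOfSquares_of_eq_zero fun x y => ?_
    have h1 := (hC.posSemidef_iff.mp hpos y).trace_eq_zero_iff.mp
      (Finset.sum_eq_zero fun i _ => by
        rw [diag_apply, ← eval_acousticTensor, ← hA, hdiag, map_zero])
    simp [form_vecMulVec, h1]
  push Not at hdiag
  obtain ⟨i, hi⟩ := hdiag
  have hAu : ∀ j, ∑ k, A j k * u k = 0 := by
    by_cases h0 : ∀ l, u l = 0
    · simp [h0]
    push Not at h0
    obtain ⟨l, hl⟩ := h0
    intro j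
    have h1 : (A * A.adjugate) j l = 0 := by rw [mul_adjugate, hdet, zero_smul]; rfl
    rw [mul_apply] at h1
    simp only [hadj, ← mul_assoc, ← Finset.sum_mul] at h1
    exact (mul_eq_zero.mp h1).resolve_right hl
  have hrk := add_crossMatrix_rank_one hsymm hadj hAu
  let ι : MvPolynomial (Fin 3) ℝ →+* MvPolynomial (Fin 3) ℂ := MvPolynomial.map Complex.ofRealHom
  have hιinj : Function.Injective ι :=
    MvPolynomial.map_injective _ Complex.ofRealHom.injective
  let I : MvPolynomial (Fin 3) ℂ := MvPolynomial.C Complex.I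
  have hI : I * I = -1 := by simp [I, ← MvPolynomial.C_mul]
  let H : Matrix (Fin 3) (Fin 3) (MvPolynomial (Fin 3) ℂ) :=
    of fun j k => ι (A j k) + I * ι (crossMatrix u j k)
  have hcross : ∀ j k, crossMatrix u j k = -crossMatrix u k j := by
    intro j k
    fin_cases j <;> fin_cases k <;> simp [crossMatrix]
  have hcrosshom : ∀ j k, (crossMatrix u j k).IsHomogeneous 2 := by
    intro j k
    have h0 := MvPolynomial.isHomogeneous_zero (Fin 3) ℝ 2
    fin_cases j <;> fin_cases k <;> simp [crossMatrix] <;>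
      first | exact h0 | exact hu _ | exact (hu _).neg
  have hιconj : ∀ p, MvPolynomial.map (starRingEnd ℂ) (ι p) = ι p := by
    intro p
    have hc : (starRingEnd ℂ).comp Complex.ofRealHom = Complex.ofRealHom :=
      RingHom.ext fun r => by simp
    simp only [ι, MvPolynomial.map_map, hc]
  have hcross0 : crossMatrix u i i = 0 := by
    fin_cases i <;> simp [crossMatrix]
  have hHii : H i i = ι (A i i) := by simp [H, hcross0]
  obtain ⟨a, b, g, q, hab, hg, hq, hfac⟩ := MvPolynomial.exists_rank_one_factor (starRingEnd ℂ)
    (fun z => Complex.conj_conj z) H 2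
    (fun j k => ((isHomogeneous_acousticTensor C j k).map _).add
      (((hcrosshom j k).map _).C_mul _))
    (fun j k => by
      simp only [H, of_apply, map_add, map_mul, hιconj]
      rw [hsymm j k, hcross j k]
      simp [I])
    i (by rw [hHii]; exact (map_ne_zero_iff ι hιinj).mpr hi)
    (fun j k => by
      have h1 := congrArg ι (hrk i j k).1
      have h2 := congrArg ι (hrk i j k).2
      simp only [map_sub, map_add, map_mul] at h1 h2
      rw [hHii]
      simp only [H, of_apply]
      linear_combination h1 + I * h2 - ι (crossMatrix u j i) * ι (crossMatrix u i k) * hI)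
  refine isBiquadraticSumOfSquares_of_factor hC hpos hab hg hq fun x y => ?_
  set G := MvPolynomial.eval (Complex.ofRealHom ∘ y) g
  set Q := fun k => MvPolynomial.eval (Complex.ofRealHom ∘ y) (q k) with hQ
  have hent : ∀ j k, C.acousticAt y j k = (G * starRingEnd ℂ (Q j) * Q k).re := by
    intro j k
    have h1 := congrArg (MvPolynomial.eval (Complex.ofRealHom ∘ y)) (hfac j k)
    simp only [H, ι, I, of_apply, map_add, map_mul, MvPolynomial.eval_comp_map, eval_map_conj,
      MvPolynomial.eval_C] at h1
    rw [hA, eval_acousticTensor] at h1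
    rw [← h1]
    simp
  have hsum : (∑ j, ∑ k, (G * starRingEnd ℂ (Q j) * Q k) * x j * x k) =
      G * ((starRingEnd ℂ (∑ k, Q k * x k)) * ∑ k, Q k * x k) := by
    rw [map_sum, Finset.sum_mul, Finset.mul_sum]
    refine Finset.sum_congr rfl fun j _ => ?_
    rw [Finset.mul_sum, Finset.mul_sum]
    refine Finset.sum_congr rfl fun k _ => ?_
    simp
    ring
  rw [← Complex.normSq_eq_conj_mul_self] at hsum
  have hre := congrArg Complex.re hsum
  rw [Complex.re_mul_ofReal] at hre
  rw [← hre, form_vecMulVec, Complex.re_sum]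
  refine Finset.sum_congr rfl fun j _ => ?_
  rw [Complex.re_sum]
  refine Finset.sum_congr rfl fun k _ => ?_
  rw [hent, Complex.re_mul_ofReal, Complex.re_mul_ofReal]

end KeyLemma

/-! ### Degenerate forms with a constant kernel -/

section ConstantKernel

open Matrix FourTensor

/-- The bilinear form `∑ c_jl y_j z_l` on Euclidean space. -/
noncomputable def euclideanBilin {d : ℕ} (c : Fin d → Fin d → ℝ) :
    EuclideanSpace ℝ (Fin d) →L[ℝ] EuclideanSpace ℝ (Fin d) →L[ℝ] ℝ :=
  ∑ j, ∑ l, c j l • (EuclideanSpace.proj (𝕜 := ℝ) j).smulRight (EuclideanSpace.proj (𝕜 := ℝ) l)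

lemma euclideanBilin_apply {d : ℕ} (c : Fin d → Fin d → ℝ) (y z : EuclideanSpace ℝ (Fin d)) :
    euclideanBilin c y z = ∑ j, ∑ l, c j l * y j * z l := by
  simp [euclideanBilin, mul_assoc]

/-- If a constant vector `w` is in the kernel of the acoustic tensor for every `y`, the biquadratic
form depends on only two of the variables `x`, and Calderón's theorem applies. -/
lemma isBiquadraticSumOfSquares_of_constant_kernel {C : FourTensor 3} (hC : C.HasUsualSymmetries)
    (hpos : ∀ x y, 0 ≤ C.form (vecMulVec x y)) {w : Fin 3 → ℝ} (hw : w ≠ 0)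
    (hker : ∀ y j, ∑ k, C.acousticAt y j k * w k = 0) :
    IsBiquadraticSumOfSquares C.form := by
  obtain ⟨i, hi⟩ := Function.ne_iff.mp hw
  rw [Pi.zero_apply] at hi
  obtain ⟨a, b, hib, hsum⟩ : ∃ a b : Fin 3, (a ≠ i ∧ b ≠ i ∧ a ≠ b) ∧
      ∀ f : Fin 3 → ℝ, ∑ k, f k = f i + f a + f b := by
    fin_cases i
    · exact ⟨1, 2, by decide, fun f => by simp [Fin.sum_univ_three]⟩
    · exact ⟨0, 2, by decide, fun f => by simp [Fin.sum_univ_three]; ring⟩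
    · exact ⟨0, 1, by decide, fun f => by simp [Fin.sum_univ_three]; ring⟩
  let B : Fin 3 → Fin 3 → EuclideanSpace ℝ (Fin 3) →L[ℝ] EuclideanSpace ℝ (Fin 3) →L[ℝ] ℝ :=
    fun p q => euclideanBilin fun j l => C p j q l
  have hB : ∀ p q (y : Fin 3 → ℝ), B p q (WithLp.toLp 2 y) (WithLp.toLp 2 y) =
      C.acousticAt y p q := fun p q y => by simp [B, euclideanBilin_apply, acousticAt]
  have hBsymm : ∀ p q y z, B p q y z = B p q z y := by
    intro p q y z
    simp only [B, euclideanBilin_apply]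
    rw [Finset.sum_comm]
    refine Finset.sum_congr rfl fun l _ => Finset.sum_congr rfl fun j _ => ?_
    rw [(hC p j q l).2]
    ring
  have hform : ∀ x y : Fin 3 → ℝ, C.form (vecMulVec x y) =
      pencilForm (B a a) (B a b) (B b b) (x a - x i * w a / w i) (x b - x i * w b / w i)
        (WithLp.toLp 2 y) := by
    intro x y
    have ki := hker y i
    have ka := hker y a
    have kb := hker y b
    rw [hsum] at ki ka kb
    have sa := hC.acousticAt_symm y a i
    have sb := hC.acousticAt_symm y b i
    have sab := hC.acousticAt_symm y b a
    simp only [pencilForm, hB, form_vecMulVec, hsum]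
    rw [sa] at ka ⊢
    rw [sb] at kb ⊢
    rw [sab] at kb ⊢
    -- the rows of `w` in the kernel express the entries in row `i` by the other ones
    have e1 : C.acousticAt y i a = -(C.acousticAt y a a * w a + C.acousticAt y a b * w b) / w i := by
      rw [eq_div_iff hi]; linarith
    have e2 : C.acousticAt y i b = -(C.acousticAt y a b * w a + C.acousticAt y b b * w b) / w i := by
      rw [eq_div_iff hi]; linarith
    have e3 : C.acousticAt y i i = -(C.acousticAt y i a * w a + C.acousticAt y i b * w b) / w i := by
      rw [eq_div_iff hi]; linarith
    rw [e3, e1, e2]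
    field_simp
    ring
  have hsos := isPencilSumOfSquares_of_nonneg 3 (F := EuclideanSpace ℝ (Fin 3)) (by simp)
    (B a a) (B a b) (B b b) (hBsymm a a) (hBsymm a b) (hBsymm b b) (by
      intro s t y
      have h := hpos (fun k => if k = a then s else if k = b then t else 0) y
      rw [hform] at h
      simpa [hib.1.symm, hib.2.1.symm, hib.2.2.symm] using h)
  obtain ⟨L, hL⟩ := hsos
  rw [isBiquadraticSumOfSquares_iff]
  let e : (EuclideanSpace ℝ (Fin 3) →L[ℝ] ℝ) → Fin 3 → ℝ := fun α j =>
    α (EuclideanSpace.single j 1)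
  have he : ∀ α (y : Fin 3 → ℝ), α (WithLp.toLp 2 y) = e α ⬝ᵥ y := by
    intro α y
    have hy : WithLp.toLp 2 y = ∑ j, y j • EuclideanSpace.single j (1 : ℝ) := by
      ext k
      simp [Pi.single_apply]
    rw [hy, map_sum]
    simp [e, dotProduct, mul_comm]
  let σ : Fin 3 → Fin 3 → ℝ := fun p => Pi.single p 1 - Pi.single i (w p / w i)
  have hσ : ∀ p (x : Fin 3 → ℝ), σ p ⬝ᵥ x = x p - x i * w p / w i := by
    intro p x
    simp only [σ, sub_dotProduct, single_dotProduct]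
    ring
  refine ⟨L.map fun p => vecMulVec (σ a) (e p.1) + vecMulVec (σ b) (e p.2), fun x y => ?_⟩
  rw [hform, hL, List.map_map]
  congr 2
  funext p
  have hadd : ∀ M N : Matrix (Fin 3) (Fin 3) ℝ,
      bilinearValue (M + N) x y = bilinearValue M x y + bilinearValue N x y := fun M N => by
    simp [bilinearValue, add_mul, Finset.sum_add_distrib]
  simp only [Function.comp_apply, hadd, bilinearValue_vecMulVec, hσ, he]

end ConstantKernel

/-! ### Degenerate forms -/

section Degenerate

open Matrix FourTensor

lemma exists_eval_ne_zero {P : MvPolynomial (Fin 3) ℝ} (hP : P ≠ 0) :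
    ∃ y, MvPolynomial.eval y P ≠ 0 := by
  by_contra! h
  exact hP (MvPolynomial.funext fun x => by rw [h, map_zero])

lemma eval_trace_adjugate_mul_nonneg {C D : FourTensor 3} (hC : C.HasUsualSymmetries)
    (hCpos : ∀ x y, 0 ≤ C.form (vecMulVec x y)) (hD : D.HasUsualSymmetries)
    (hDpos : ∀ x y, 0 ≤ D.form (vecMulVec x y)) (y : Fin 3 → ℝ) :
    0 ≤ MvPolynomial.eval y (C.acousticTensor.adjugate * D.acousticTensor).trace := by
  rw [eval_trace_adjugate_mul]
  exact trace_mul_nonneg (posSemidef_adjugate (hC.posSemidef_iff.mp hCpos y))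
    (hD.posSemidef_iff.mp hDpos y)

/-- A nonnegative biquadratic form whose acoustic tensor `A` is degenerate is a sum of squares, if
it is a summand of a nondegenerate form and the mixed term `tr (adj A * B)` of the determinant of
the sum is a multiple of an extremal polynomial.

The adjugate has rank one, hence is `g u uᵀ` with `deg g + 2 deg u = 4`. If `u` is constant it spans
a constant kernel. If `g` is constant it is absorbed into `u`. If `g` is quadratic, it is a sum of
squares and a factor of the mixed term, and is a square by extremality. -/
lemma isBiquadraticSumOfSquares_of_det_eq_zero {C D : FourTensor 3} (hC : C.HasUsualSymmetries)
    (hCpos : ∀ x y, 0 ≤ C.form (vecMulVec x y)) (hD : D.HasUsualSymmetries)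
    (hDpos : ∀ x y, 0 ≤ D.form (vecMulVec x y)) (hdet : C.acousticTensor.det = 0)
    (hsum : (C + D).acousticTensor.det ≠ 0) {P : MvPolynomial (Fin 3) ℝ}
    (hP : P.IsHomogeneous 6) (hext : IsExtremalPolynomial P) {e : ℝ}
    (htr : (C.acousticTensor.adjugate * D.acousticTensor).trace = e • P) :
    IsBiquadraticSumOfSquares C.form := by
  set A := C.acousticTensor with hA
  set M := A.adjugate with hM
  have hAsymm : ∀ j k, A j k = A k j := hC.acousticTensor_symm
  have hAT : Aᵀ = A := by ext1 j k; exact hAsymm k j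
  have hMsymm : ∀ j k, M j k = M k j := by
    intro j k
    have h1 : Mᵀ = M := by rw [hM, adjugate_transpose, hAT]
    exact (congrFun₂ h1 j k).symm
  have hMpsd : ∀ y, (C.acousticAt y).adjugate.PosSemidef := fun y =>
    posSemidef_adjugate (hC.posSemidef_iff.mp hCpos y)
  have hMeval : ∀ y j k, MvPolynomial.eval y (M j k) = (C.acousticAt y).adjugate j k :=
    fun y j k => eval_adjugate_acousticTensor C y j k
  have hMhom : ∀ j k, (M j k).IsHomogeneous 4 :=
    isHomogeneous_adjugate (isHomogeneous_acousticTensor C)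
  by_cases hM0 : M = 0
  · exact isBiquadraticSumOfSquares_of_adjugate_eq hC hCpos hdet (u := 0)
      (fun _ => MvPolynomial.isHomogeneous_zero _ _ _) (fun j k => by
        rw [← hA, ← hM, hM0]; simp)
  obtain ⟨i, hi⟩ : ∃ i, M i i ≠ 0 := by
    by_contra! hall
    refine hM0 (Matrix.ext fun j k => MvPolynomial.funext fun y => ?_)
    have h1 := (hMpsd y).trace_eq_zero_iff.mp (Finset.sum_eq_zero fun i _ => by
      rw [diag_apply, ← hMeval, hall, map_zero])
    rw [hMeval, h1]
    simp
  have hadj0 : M.adjugate = 0 := by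
    rw [hM, adjugate_adjugate _ (by simp), hdet]
    simp
  obtain ⟨a, b, g, u, hab, hg, hu, hfac⟩ := MvPolynomial.exists_rank_one_factor (RingHom.id ℝ)
    (fun _ => rfl) M 4 hMhom (fun j k => by rw [MvPolynomial.map_id, hMsymm]) i hi
    fun j k => rank_one_of_adjugate_eq_zero hadj0 i j k
  simp only [MvPolynomial.map_id] at hfac
  have hgpos : ∀ y, 0 ≤ MvPolynomial.eval y g := by
    refine MvPolynomial.nonneg_of_eval_ne_zero hi (MvPolynomial.continuous_eval g) fun y hy => ?_
    have h1 : 0 ≤ MvPolynomial.eval y (M i i) := by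
      rw [hMeval]; exact (hMpsd y).diag_nonneg
    rw [hfac, mul_assoc, map_mul, map_mul] at h1 hy
    have h2 : 0 < MvPolynomial.eval y (u i) * MvPolynomial.eval y (u i) :=
      (mul_self_nonneg _).lt_of_ne' (right_ne_zero_of_mul hy)
    exact nonneg_of_mul_nonneg_left h1 h2
  have hg0 : g ≠ 0 := fun h => hi (by rw [hfac, h]; ring)
  -- it suffices that `g` is a square
  have hsquare : ∀ (p : MvPolynomial (Fin 3) ℝ) (k : ℕ), p.IsHomogeneous k → k + b = 2 →
      g = p ^ 2 → IsBiquadraticSumOfSquares C.form := by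
    intro p k hp hk hgp
    refine isBiquadraticSumOfSquares_of_adjugate_eq hC hCpos hdet (u := fun j => p * u j)
      (fun j => hk ▸ hp.mul (hu j)) fun j k => ?_
    rw [← hA, ← hM, hfac, hgp]
    ring
  obtain ⟨rfl, rfl⟩ | ⟨rfl, rfl⟩ | ⟨rfl, rfl⟩ :
    (a = 0 ∧ b = 2) ∨ (a = 2 ∧ b = 1) ∨ (a = 4 ∧ b = 0) := by omega
  · obtain ⟨r, rfl⟩ := hg.eq_C_of_degree_zero
    have hr : 0 ≤ r := by simpa using hgpos 0
    exact hsquare (MvPolynomial.C (Real.sqrt r)) 0 (MvPolynomial.isHomogeneous_C _ _) rfl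
      (by rw [← MvPolynomial.C_pow, Real.sq_sqrt hr])
  · obtain ⟨m, l, hl, hgl⟩ := hg.exists_sum_sq hgpos
    set W := ∑ j, ∑ k, u j * D.acousticTensor j k * u k with hW
    have htrW : (M * D.acousticTensor).trace = g * W := by
      simp only [trace, diag_apply, mul_apply, hW, Finset.mul_sum, hfac]
      refine Finset.sum_congr rfl fun j _ => Finset.sum_congr rfl fun k _ => ?_
      rw [hD.acousticTensor_symm j k]
      ring
    have hWhom : W.IsHomogeneous (2 * 2) :=
      MvPolynomial.IsHomogeneous.sum _ _ _ fun j _ => MvPolynomial.IsHomogeneous.sum _ _ _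
        fun k _ => ((hu j).mul (isHomogeneous_acousticTensor D j k)).mul (hu k)
    have hWpos : ∀ y, 0 ≤ MvPolynomial.eval y W := by
      intro y
      have h1 := hDpos (fun j => MvPolynomial.eval y (u j)) y
      rw [form_vecMulVec] at h1
      convert h1 using 1
      simp only [hW, map_sum, map_mul, eval_acousticTensor]
      refine Finset.sum_congr rfl fun j _ => Finset.sum_congr rfl fun k _ => ?_
      ring
    have htr0 : (M * D.acousticTensor).trace ≠ 0 := by
      intro h0
      apply hM0
      -- `tr (adj A * (A + B))` vanishes and `A + B` is generically positive definite
      have hz : ∀ y, MvPolynomial.eval y (C + D).acousticTensor.det ≠ 0 →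
          (C.acousticAt y).adjugate = 0 := by
        intro y hy
        have hCDpos : ∀ x y, 0 ≤ (C + D).form (vecMulVec x y) := fun x y => by
          rw [form_add]; exact add_nonneg (hCpos x y) (hDpos x y)
        refine eq_zero_of_trace_mul_eq_zero (hMpsd y)
          (((hC.add hD).posSemidef_iff.mp hCDpos y).posDef_iff_det_ne_zero.mpr
            (by rwa [← eval_det_acousticTensor])) ?_
        rw [← eval_trace_adjugate_mul, acousticTensor_add, mul_add, trace_add, ← hA, ← hM, h0,
          hM, adjugate_mul, hdet]
        simp
      ext1 j k
      refine (mul_eq_zero.mp (?_ : M j k * (C + D).acousticTensor.det = 0)).resolve_right hsum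
      refine MvPolynomial.funext fun y => ?_
      rw [map_mul, map_zero, hMeval]
      by_cases hy : MvPolynomial.eval y (C + D).acousticTensor.det = 0
      · rw [hy, mul_zero]
      · rw [hz y hy, Matrix.zero_apply, zero_mul]
    have he : 0 < e := by
      have he0 : e ≠ 0 := fun h => htr0 (by rw [htr, h, zero_smul])
      obtain ⟨n, ⟨-, hP0, hPpos⟩, -⟩ := hext
      obtain ⟨y, hy⟩ := exists_eval_ne_zero hP0
      have h1 := eval_trace_adjugate_mul_nonneg hC hCpos hD hDpos y
      rw [← hA, ← hM, htr, MvPolynomial.smul_eval] at h1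
      exact (nonneg_of_mul_nonneg_left h1 ((hPpos y).lt_of_ne' hy)).lt_of_ne' he0
    obtain ⟨p, hp, hpW⟩ := exists_sq_mul_eq (k := 1) (l := 2) hP hext he l hl hWhom hWpos
      (by rw [← hgl, ← htrW, htr])
    have hW0 : W ≠ 0 := fun h => htr0 (by rw [htrW, h, mul_zero])
    refine hsquare (MvPolynomial.C (Real.sqrt e) * p) 1 (hp.C_mul _) rfl
      (mul_right_cancel₀ hW0 ?_)
    rw [← htrW, htr, mul_pow, ← MvPolynomial.C_pow, Real.sq_sqrt he.le, mul_assoc, hpW,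
      MvPolynomial.smul_eq_C_mul]
  · choose w hw using fun k => (hu k).eq_C_of_degree_zero
    refine isBiquadraticSumOfSquares_of_constant_kernel hC hCpos (w := w) ?_ ?_
    · rintro rfl
      exact hi (by rw [hfac, hw]; simp)
    · have hui : u i ≠ 0 := fun h => hi (by rw [hfac, h]; ring)
      have hker : ∀ j, ∑ k, A j k * u k = 0 := by
        intro j
        have h1 : (A * M) j i = 0 := by rw [hM, mul_adjugate, hdet, zero_smul]; rfl
        rw [mul_apply] at h1
        have h2 : ∑ k, A j k * M k i = (∑ k, A j k * u k) * (g * u i) := by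
          rw [Finset.sum_mul]
          refine Finset.sum_congr rfl fun k _ => ?_
          rw [hfac]
          ring
        rw [h2] at h1
        exact (mul_eq_zero.mp h1).resolve_right (mul_ne_zero hg0 hui)
      intro y j
      have h1 := congrArg (MvPolynomial.eval y) (hker j)
      simpa [hw, hA, eval_acousticTensor] using h1

end Degenerate

/-! ### Extremal determinants -/

section Main

open Matrix FourTensor

/-- If the biquadratic form is a sum of squares, so is the determinant of the acoustic tensor, by
the Cauchy–Binet formula; if it is also extremal then it is a single square. -/
lemma isSquare_det_of_isBiquadraticSumOfSquares {C : FourTensor 3} (hC : C.HasUsualSymmetries)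
    (hext : IsExtremalPolynomial C.acousticTensor.det)
    (h : IsBiquadraticSumOfSquares C.form) : IsSquare C.acousticTensor.det := by
  obtain ⟨m, B, hB⟩ := h
  let V : Matrix (Fin 3) (Fin m) (MvPolynomial (Fin 3) ℝ) :=
    of fun i s => ∑ j, MvPolynomial.C (B s i j) * MvPolynomial.X j
  have hVhom : ∀ i s, (V i s).IsHomogeneous 1 := fun i s => by
    simp only [V, of_apply]
    exact MvPolynomial.IsHomogeneous.sum _ _ _ fun j _ => MvPolynomial.isHomogeneous_C_mul_X _ _
  have hV : C.acousticTensor = V * Vᵀ := by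
    ext1 i k
    refine MvPolynomial.funext fun y => ?_
    have hval : ∀ i k, MvPolynomial.eval y ((V * Vᵀ) i k) =
        ∑ s, (∑ j, B s i j * y j) * ∑ l, B s k l * y l := fun i k => by
      simp [V, mul_apply]
    have h0 := eq_zero_of_quadratic_eq_zero
      (a := fun i k => C.acousticAt y i k - ∑ s, (∑ j, B s i j * y j) * ∑ l, B s k l * y l)
      (fun i k => by
        rw [hC.acousticAt_symm]
        congr 1
        exact Finset.sum_congr rfl fun s _ => mul_comm _ _)
      (fun x => by
        have h1 := hB x y
        rw [form_vecMulVec] at h1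
        simp only [sub_mul, Finset.sum_sub_distrib, h1]
        rw [sub_eq_zero]
        have h2 : ∀ s, (∑ i, ∑ j, B s i j * x i * y j) = ∑ i, (∑ j, B s i j * y j) * x i :=
          fun s => by
            refine Finset.sum_congr rfl fun i _ => ?_
            rw [Finset.sum_mul]
            exact Finset.sum_congr rfl fun j _ => by ring
        have h3 : ∀ s, (∑ i, (∑ j, B s i j * y j) * x i) ^ 2 =
            ∑ i, ∑ k, (∑ j, B s i j * y j) * x i * ((∑ l, B s k l * y l) * x k) :=
          fun s => by rw [sq, Finset.sum_mul_sum]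
        simp only [h2, h3]
        rw [Finset.sum_comm]
        refine Finset.sum_congr rfl fun i _ => ?_
        rw [Finset.sum_comm]
        refine Finset.sum_congr rfl fun k _ => ?_
        rw [Finset.sum_mul, Finset.sum_mul]
        refine Finset.sum_congr rfl fun s _ => ?_
        ring) i k
    rw [eval_acousticTensor, hval]
    exact sub_eq_zero.mp h0
  have hdet3 : ∀ s t r, (V.submatrix id ![s, t, r]).det.IsHomogeneous 3 := by
    intro s t r
    rw [det_apply]
    refine MvPolynomial.IsHomogeneous.sum _ _ _ fun σ _ => ?_
    have h1 : (∏ i, V.submatrix id ![s, t, r] (σ i) i).IsHomogeneous (∑ _i : Fin 3, 1) :=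
      MvPolynomial.IsHomogeneous.prod _ _ _ fun i _ => hVhom _ _
    rcases Int.units_eq_one_or (Equiv.Perm.sign σ) with hs | hs <;> rw [hs]
    · simpa using h1
    · simpa using h1.neg
  obtain ⟨p, -, hp⟩ := exists_sq_mul_eq (k := 3) (l := 0) (W := 1) (c := 6)
    (isHomogeneous_det (isHomogeneous_acousticTensor C)) hext (by norm_num)
    (ι := Fin m × Fin m × Fin m) (fun z => (V.submatrix id ![z.1, z.2.1, z.2.2]).det)
    (fun z => hdet3 _ _ _) (MvPolynomial.isHomogeneous_one _ _) (fun _ => by simp) (by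
      rw [mul_one, Fintype.sum_prod_type, hV, MvPolynomial.smul_eq_C_mul]
      simp only [Fintype.sum_prod_type]
      rw [← six_mul_det_mul_transpose]
      congr 1)
  exact ⟨p, by rw [← hp]; ring⟩

/-- If `C + D` has an extremal determinant, the four terms of the expansion of the determinant of
the sum are multiples of it. -/
lemma exists_smul_of_add {C D : FourTensor 3} (hC : C.HasUsualSymmetries)
    (hCpos : ∀ x y, 0 ≤ C.form (vecMulVec x y)) (hD : D.HasUsualSymmetries)
    (hDpos : ∀ x y, 0 ≤ D.form (vecMulVec x y))
    (hext : IsExtremalPolynomial (C + D).acousticTensor.det) :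
    ∃ c : Fin 4 → ℝ, C.acousticTensor.det = c 0 • (C + D).acousticTensor.det ∧
      (C.acousticTensor.adjugate * D.acousticTensor).trace = c 1 • (C + D).acousticTensor.det ∧
      (D.acousticTensor.adjugate * C.acousticTensor).trace = c 2 • (C + D).acousticTensor.det ∧
      D.acousticTensor.det = c 3 • (C + D).acousticTensor.det := by
  have hCh := isHomogeneous_acousticTensor C
  have hDh := isHomogeneous_acousticTensor D
  have hdetpos : ∀ {E : FourTensor 3}, E.HasUsualSymmetries →
      (∀ x y, 0 ≤ E.form (vecMulVec x y)) → ∀ y, 0 ≤ MvPolynomial.eval y E.acousticTensor.det :=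
    fun hE hEpos y => by
      rw [eval_det_acousticTensor]; exact (hE.posSemidef_iff.mp hEpos y).det_nonneg
  have h := exists_smul_of_sum_eq (n := 3)
    (isHomogeneous_det (isHomogeneous_acousticTensor (C + D))) hext
    ![C.acousticTensor.det, (C.acousticTensor.adjugate * D.acousticTensor).trace,
      (D.acousticTensor.adjugate * C.acousticTensor).trace, D.acousticTensor.det]
    (by
      intro i
      fin_cases i
      · exact isHomogeneous_det hCh
      · exact isHomogeneous_trace_adjugate_mul hCh hDh
      · exact isHomogeneous_trace_adjugate_mul hDh hCh
      · exact isHomogeneous_det hDh)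
    (by
      intro i
      fin_cases i
      · exact hdetpos hC hCpos
      · exact eval_trace_adjugate_mul_nonneg hC hCpos hD hDpos
      · exact eval_trace_adjugate_mul_nonneg hD hDpos hC hCpos
      · exact hdetpos hD hDpos)
    (by
      have h := det_add_smul_fin_three C.acousticTensor D.acousticTensor 1 1
      simp only [one_smul, one_pow, one_mul] at h
      rw [acousticTensor_add, h, Fin.sum_univ_four]
      rfl)
  choose c hc using h
  exact ⟨c, hc 0, hc 1, hc 2, hc 3⟩

/-- The generalized eigenvalues of `D` with respect to `C` do not depend on the direction `y`. With
`a` the smallest and `b` the largest of them, `D - a C` and `b C - D` are nonnegative and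
degenerate. -/
lemma exists_degenerate_bounds {C D : FourTensor 3} (hC : C.HasUsualSymmetries)
    (hCpos : ∀ x y, 0 ≤ C.form (vecMulVec x y)) (hD : D.HasUsualSymmetries)
    (hDpos : ∀ x y, 0 ≤ D.form (vecMulVec x y))
    (hCD : ∀ x y, 0 ≤ (C - D).form (vecMulVec x y))
    (hext : IsExtremalPolynomial C.acousticTensor.det) :
    ∃ a b : ℝ, a ≤ b ∧
      (∀ x y, 0 ≤ (D - a • C).form (vecMulVec x y)) ∧ (D - a • C).acousticTensor.det = 0 ∧
      (∀ x y, 0 ≤ (b • C - D).form (vecMulVec x y)) ∧ (b • C - D).acousticTensor.det = 0 := by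
  have hP0 : C.acousticTensor.det ≠ 0 := by obtain ⟨n, ⟨-, h0, -⟩, -⟩ := hext; exact h0
  have hsum : D + (C - D) = C := add_sub_cancel D C
  obtain ⟨c, h0, h1, h2, h3⟩ := exists_smul_of_add hD hDpos (hC.sub hD) hCD (by rwa [hsum])
  rw [hsum] at h0 h1 h2 h3
  -- the characteristic polynomial of the pencil is a multiple of `det T`
  obtain ⟨p, hp⟩ : ∃ p : ℝ → ℝ, ∀ t, (D - t • C).acousticTensor.det =
      p t • C.acousticTensor.det := by
    refine ⟨fun t => (1 - t) ^ 3 * c 0 + (1 - t) ^ 2 * (-t) * c 1 + (1 - t) * (-t) ^ 2 * c 2 +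
      (-t) ^ 3 * c 3, fun t => ?_⟩
    have h : D - t • C = (1 - t) • D + (-t) • (C - D) := by module
    have h' := det_add_smul_fin_three D.acousticTensor (C - D).acousticTensor
      (MvPolynomial.C (1 - t)) (MvPolynomial.C (-t))
    rw [h0, h1, h2, h3] at h'
    have hsm : ∀ (r : ℝ) (E : FourTensor 3), (r • E).acousticTensor =
        (MvPolynomial.C r : MvPolynomial (Fin 3) ℝ) • E.acousticTensor := fun r E => by
      rw [acousticTensor_smul]
      ext1 i k
      simp [MvPolynomial.smul_eq_C_mul]
    rw [h, acousticTensor_add, hsm, hsm, h']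
    simp only [MvPolynomial.smul_eq_C_mul, map_add, map_mul, map_pow]
    ring
  -- simultaneous diagonalization where `C` is nondegenerate
  have hdiag : ∀ y, MvPolynomial.eval y C.acousticTensor.det ≠ 0 →
      ∃ (P : Matrix (Fin 3) (Fin 3) ℝ) (μ : Fin 3 → ℝ), C.acousticAt y = Pᵀ * P ∧
        D.acousticAt y = Pᵀ * diagonal μ * P ∧ ∀ t, p t = ∏ i, (μ i - t) := by
    intro y hy
    have hyd : (C.acousticAt y).det ≠ 0 := by rwa [← eval_det_acousticTensor]
    obtain ⟨P, μ, hCP, hDP⟩ := exists_simultaneous_diagonalization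
      ((hC.posSemidef_iff.mp hCpos y).posDef_iff_det_ne_zero.mpr hyd)
      (hD.acousticAt_isHermitian y)
    refine ⟨P, μ, hCP, hDP, fun t => ?_⟩
    have h1 := congrArg (MvPolynomial.eval y) (hp t)
    have h2 : (D - t • C).acousticAt y = Pᵀ * diagonal (fun i => μ i - t) * P := by
      have h3 : (D - t • C).acousticAt y = D.acousticAt y - t • C.acousticAt y := by
        ext i k
        simp only [← eval_acousticTensor, acousticTensor_sub, acousticTensor_smul]
        simp [eval_acousticTensor, MvPolynomial.smul_eval]
      have h4 : diagonal (fun i => μ i - t) = diagonal μ - t • (1 : Matrix (Fin 3) (Fin 3) ℝ) := by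
        rw [smul_one_eq_diagonal, diagonal_sub]
      rw [h3, hCP, hDP, h4, Matrix.mul_sub, Matrix.sub_mul]
      simp
    rw [MvPolynomial.smul_eval, eval_det_acousticTensor, eval_det_acousticTensor, h2] at h1
    have h5 : (C.acousticAt y).det = P.det * P.det := by rw [hCP, det_mul, det_transpose]
    rw [det_mul, det_mul, det_transpose, det_diagonal, h5] at h1
    rw [h5] at hyd
    refine mul_right_cancel₀ hyd ?_
    rw [← h1]
    ring
  obtain ⟨y₀, hy₀⟩ := exists_eval_ne_zero hP0
  obtain ⟨-, μ₀, -, -, hμ₀⟩ := hdiag y₀ hy₀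
  have hmem : ∀ μ : Fin 3 → ℝ, (∀ t, p t = ∏ i, (μ i - t)) → ∀ i, ∃ j, μ i = μ₀ j := by
    intro μ hμ i
    have h1 : ∏ j, (μ₀ j - μ i) = 0 := by
      rw [← hμ₀, hμ]
      exact Finset.prod_eq_zero (Finset.mem_univ i) (sub_self _)
    obtain ⟨j, -, hj⟩ := Finset.prod_eq_zero_iff.mp h1
    exact ⟨j, (sub_eq_zero.mp hj).symm⟩
  obtain ⟨ia, hia⟩ := Finite.exists_min μ₀
  obtain ⟨ib, hib⟩ := Finite.exists_max μ₀
  have hroot : ∀ i, p (μ₀ i) = 0 := fun i => by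
    rw [hμ₀]
    exact Finset.prod_eq_zero (Finset.mem_univ i) (sub_self _)
  have hval : ∀ (P : Matrix (Fin 3) (Fin 3) ℝ) (ν x : Fin 3 → ℝ),
      x ⬝ᵥ ((Pᵀ * diagonal ν * P) *ᵥ x) = ∑ i, ν i * (P *ᵥ x) i ^ 2 := by
    intro P ν x
    rw [← mulVec_mulVec, ← mulVec_mulVec, dotProduct_mulVec, vecMul_transpose]
    simp only [dotProduct, mulVec_diagonal]
    exact Finset.sum_congr rfl fun i _ => by ring
  have hval1 : ∀ (P : Matrix (Fin 3) (Fin 3) ℝ) (x : Fin 3 → ℝ),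
      x ⬝ᵥ ((Pᵀ * P) *ᵥ x) = ∑ i, (P *ᵥ x) i ^ 2 := by
    intro P x
    simpa using hval P 1 x
  refine ⟨μ₀ ia, μ₀ ib, hia ib, fun x => ?_, by rw [hp, hroot, zero_smul], fun x => ?_, ?_⟩
  · refine MvPolynomial.nonneg_of_eval_ne_zero hP0 (continuous_form_vecMulVec _ x) fun y hy => ?_
    obtain ⟨P, μ, hCP, hDP, hμ⟩ := hdiag y hy
    rw [form_sub, form_smul, Pi.sub_apply, Pi.smul_apply, form_vecMulVec_eq_dotProduct,
      form_vecMulVec_eq_dotProduct, hCP,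
      hDP, hval, hval1, smul_eq_mul, Finset.mul_sum, ← Finset.sum_sub_distrib]
    refine Finset.sum_nonneg fun i _ => ?_
    obtain ⟨j, hj⟩ := hmem μ hμ i
    rw [← sub_mul, hj]
    exact mul_nonneg (sub_nonneg.mpr (hia j)) (sq_nonneg _)
  · refine MvPolynomial.nonneg_of_eval_ne_zero hP0 (continuous_form_vecMulVec _ x) fun y hy => ?_
    obtain ⟨P, μ, hCP, hDP, hμ⟩ := hdiag y hy
    rw [form_sub, form_smul, Pi.sub_apply, Pi.smul_apply, form_vecMulVec_eq_dotProduct,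
      form_vecMulVec_eq_dotProduct, hCP,
      hDP, hval, hval1, smul_eq_mul, Finset.mul_sum, ← Finset.sum_sub_distrib]
    refine Finset.sum_nonneg fun i _ => ?_
    obtain ⟨j, hj⟩ := hmem μ hμ i
    rw [← sub_mul, hj]
    exact mul_nonneg (sub_nonneg.mpr (hib j)) (sq_nonneg _)
  · have h : μ₀ ib • C - D = (-1 : ℝ) • (D - μ₀ ib • C) := by module
    rw [h, acousticTensor_smul, det_smul_of_tower, hp, hroot, zero_smul, smul_zero]

/-- A form of the cone with extremal determinant that does not span an extreme ray is a sum of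
squares: it is a sum of two degenerate forms of the cone. -/
lemma isExtremeRay_or_isBiquadraticSumOfSquares {C : FourTensor 3} (hC : C.HasUsualSymmetries)
    (hf : C.form ∈ quasiconvexCone 3) (hext : IsExtremalPolynomial C.acousticTensor.det) :
    IsExtremeRay C.form ∨ IsBiquadraticSumOfSquares C.form := by
  have hCpos := hf.2
  have hP0 : C.acousticTensor.det ≠ 0 := by obtain ⟨n, ⟨-, h0, -⟩, -⟩ := hext; exact h0
  rw [or_iff_not_imp_right]
  intro hsos
  refine ⟨hf, ?_, ?_⟩
  · intro h0
    exact hsos (isBiquadraticSumOfSquares_of_eq_zero fun x y => by rw [h0]; rfl)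
  rintro _ ⟨⟨D, hD, rfl⟩, hDpos⟩ ⟨-, hCDpos⟩
  rw [← form_sub] at hCDpos
  obtain ⟨a, b, hab, hapos, hadet, hbpos, hbdet⟩ :=
    exists_degenerate_bounds hC hCpos hD hDpos hCDpos hext
  rcases hab.eq_or_lt with rfl | hlt
  · refine ⟨a, ?_⟩
    have h : D - a • C = 0 := (hD.sub (hC.smul a)).eq_zero fun x y => by
      have h1 := hapos x y
      have h2 := hbpos x y
      rw [form_sub, Pi.sub_apply] at h1 h2 ⊢
      linarith
    rw [sub_eq_zero.mp h, form_smul]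
  · exfalso
    apply hsos
    set δ := b - a with hδ
    have hδ0 : 0 < δ := sub_pos.mpr hlt
    set E := δ⁻¹ • (D - a • C) with hE
    set F := δ⁻¹ • (b • C - D) with hF
    have hEF : E + F = C := by
      have h : E + F = δ⁻¹ • δ • C := by rw [hE, hF, hδ]; module
      rw [h, smul_smul, inv_mul_cancel₀ hδ0.ne', one_smul]
    have hEs : E.HasUsualSymmetries := (hD.sub (hC.smul a)).smul _
    have hFs : F.HasUsualSymmetries := ((hC.smul b).sub hD).smul _
    have hEpos : ∀ x y, 0 ≤ E.form (vecMulVec x y) := fun x y => by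
      rw [hE, form_smul]; exact mul_nonneg (inv_nonneg.mpr hδ0.le) (hapos x y)
    have hFpos : ∀ x y, 0 ≤ F.form (vecMulVec x y) := fun x y => by
      rw [hF, form_smul]; exact mul_nonneg (inv_nonneg.mpr hδ0.le) (hbpos x y)
    have hEdet : E.acousticTensor.det = 0 := by
      rw [hE, acousticTensor_smul, det_smul_of_tower, hadet, smul_zero]
    have hFdet : F.acousticTensor.det = 0 := by
      rw [hF, acousticTensor_smul, det_smul_of_tower, hbdet, smul_zero]
    obtain ⟨c, -, h1, h2, -⟩ := exists_smul_of_add hEs hEpos hFs hFpos (by rwa [hEF])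
    rw [hEF] at h1 h2
    have hhom := isHomogeneous_det (isHomogeneous_acousticTensor C)
    rw [← hEF, form_add]
    exact (isBiquadraticSumOfSquares_of_det_eq_zero hEs hEpos hFs hFpos hEdet (by rwa [hEF]) hhom
      hext h1).add (isBiquadraticSumOfSquares_of_det_eq_zero hFs hFpos hEs hEpos hFdet
      (by rwa [add_comm, hEF]) hhom hext h2)

end Main

theorem theorem2p1 (C : FourTensor 3) (hC : C.HasUsualSymmetries)
    (hf : C.form ∈ quasiconvexCone 3)
    (hdet : IsExtremalPolynomial C.acousticTensor.det) :
    (¬ IsSquare C.acousticTensor.det → IsExtremeRay C.form) ∧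
    (IsSquare C.acousticTensor.det →
      IsExtremeRay C.form ∨ (IsPolyconvex C.form ∧ IsBiquadraticSumOfSquares C.form)) := by
  have h := isExtremeRay_or_isBiquadraticSumOfSquares hC hf hdet
  exact ⟨fun hns => h.resolve_right fun hsos =>
      hns (isSquare_det_of_isBiquadraticSumOfSquares hC hdet hsos),
    fun _ => h.imp_right fun hsos => ⟨isPolyconvex_of_isBiquadraticSumOfSquares hC hsos, hsos⟩⟩
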